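/- Let $(M,g)$ be a globally hyperbolic, time-oriented Lorentzian manifold of signature $(-,+,\dots,+)$ ($M$ smooth, Hausdorff, $\sigma$-compact; no closed causal curves, and $J^+(p)\cap J^-(q)$ compact for all $p,q\in M$). Bundles are smooth complex vector bundles of finite rank; a hermitian structure on a bundle $V$ is a smooth fibrewise non-degenerate (not necessarily positive) hermitian form $(\cdot,\cdot)_V$. It gives the pairing $(u|v)_V=\int_M (u(x),v(x))_V\,d\mathrm{Vol}_g$ on the space $\Gamma_{\rm c}(M;V)$ of compactly supported smooth sections, and the formal adjoint $A^*$ of a differential operator $A$ is taken with respect to these pairings. For a differential operator $A:\Gamma(M;V)\to\Gamma(M;V)$ on smooth sections, a retarded (resp. advanced) propagator is a linear map $G^\pm_A:\Gamma_{\rm c}(M;V)\to\Gamma(M;V)$ with upper sign (resp. lower sign) such that $A\,G_A^\pm u=u$, $G_A^\pm A u=u$ and $\operatorname{supp}G^\pm_A u\subset J^\pm(\operatorname{supp}u)$ for all $u\in\Gamma_{\rm c}(M;V)$. The operator $A$ is Green hyperbolic if $A$ and $A^*$ both possess retarded and advanced propagators. Let $V_0,V_1$ be bundles over $M$ with hermitian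 structures, let $P$ be a differential operator on $\Gamma(M;V_1)$ with $P^*=P$, and let $K\neq 0$ be a differential operator $\Gamma(M;V_0)\to\Gamma(M;V_1)$ with $PK=0$. Assume that $$D:=P+KK^*\quad\text{and}\quad Q:=K^*K$$ are Green hyperbolic. (These are the Hack–Schenkel hypotheses with $T=K$.) Then for every $\alpha\in\mathbb R$ the operator $$L=\begin{pmatrix}P&K&0&0\\K^*&-\alpha\mathbf 1&0&0\\0&0&0&K^*K\\0&0&K^*K&0\end{pmatrix}$$ on $\Gamma(M;V_1\oplus V_0^{\oplus 3})$, where $V_1\oplus V_0^{\oplus3}$ carries the orthogonal direct sum hermitian structure, is Green hyperbolic. Moreover, for each sign $\pm$, the propagator $G_D^\pm$ has a unique linear extension, still denoted $G_D^\pm$, to the space of smooth sections of $V_1$ with support contained in $J^\pm(C)$ for some compact $C\subset M$, which maps this space to itself, is a two-sided inverse of $D$ there and satisfies $\operatorname{supp}G_D^\pm w\subset J^\pm(\operatorname{supp}w)$; and $L$ has exactly one retarded (resp. advanced) propagator, namely $$G_L^\pm=\begin{pmatrix}G_D^\pm\big(\mathbf 1+(\alpha-1)KK^*G_D^\pm\big)&KG_Q^\pm&0&0\\K^*G_D^\pm&0&0&0\\0&0&0&G_Q^\pm\\0&0&G_Q^\pm&0\end{pmatrix}.$$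 -/

import Mathlib

open Bundle Set Filter Topology MeasureTheory
open scoped Manifold ContDiff Bundle

set_option linter.unusedSectionVars false

noncomputable section

namespace GreenHyp

/-! ### Smooth sections of complex vector bundles over a real manifold -/

section Sections

variable (n : ℕ) {M : Type*} [TopologicalSpace M] [ChartedSpace (EuclideanSpace ℝ (Fin n)) M]
  (F : Type*) [NormedAddCommGroup F] [NormedSpace ℂ F]
  (V : M → Type*) [TopologicalSpace (TotalSpace F V)] [∀ x, AddCommGroup (V x)]
  [∀ x, Module ℂ (V x)] [∀ x, TopologicalSpace (V x)] [FiberBundle F V] [VectorBundle ℂ F V]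

/-- A complex vector bundle over a real manifold is smooth if its (fibrewise complex linear)
transition functions depend smoothly on the base point. -/
class SmoothComplexBundle : Prop where
  contMDiffOn_coordChangeL :
    ∀ (e e' : Trivialization F (TotalSpace.proj : TotalSpace F V → M))
      [MemTrivializationAtlas e] [MemTrivializationAtlas e'],
      ContMDiffOn (𝓡 n) 𝓘(ℝ, F →L[ℂ] F) ∞
        (fun x : M => (e.coordChangeL ℂ e' x : F →L[ℂ] F)) (e.baseSet ∩ e'.baseSet)

/-- The complex vector space `Γ(M; V)` of smooth sections. -/
def Sec : Submodule ℂ (∀ x, V x) where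
  carrier := {s | ContMDiff (𝓡 n) ((𝓡 n).prod 𝓘(ℝ, F)) ∞ (fun x => TotalSpace.mk' F x (s x))}
  add_mem' := by
    intro s t hs ht x₀
    have hs := (contMDiffAt_section x₀).1 (hs x₀)
    have ht := (contMDiffAt_section x₀).1 (ht x₀)
    refine (contMDiffAt_section x₀).2 ((hs.add ht).congr_of_eventuallyEq ?_)
    filter_upwards [(trivializationAt F V x₀).open_baseSet.mem_nhds
      (mem_baseSet_trivializationAt F V x₀)] with x hx
    exact ((trivializationAt F V x₀).linear ℂ hx).1 _ _
  zero_mem' := by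
    intro x₀
    refine (contMDiffAt_section x₀).2
      ((contMDiffAt_const (c := (0 : F))).congr_of_eventuallyEq ?_)
    filter_upwards [(trivializationAt F V x₀).open_baseSet.mem_nhds
      (mem_baseSet_trivializationAt F V x₀)] with x hx
    exact ((trivializationAt F V x₀).linear ℂ hx).map_zero
  smul_mem' := by
    intro c s hs x₀
    have hs := (contMDiffAt_section x₀).1 (hs x₀)
    have hc : ContMDiff 𝓘(ℝ, F) 𝓘(ℝ, F) ∞ (fun v : F => c • v) :=
      (contDiff_const_smul c).contMDiff
    refine (contMDiffAt_section x₀).2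
      ((hc.contMDiffAt.comp x₀ hs).congr_of_eventuallyEq ?_)
    filter_upwards [(trivializationAt F V x₀).open_baseSet.mem_nhds
      (mem_baseSet_trivializationAt F V x₀)] with x hx
    exact ((trivializationAt F V x₀).linear ℂ hx).2 _ _

variable {V} in
/-- The support of a section. -/
def supp (s : ∀ x, V x) : Set M := closure {x | s x ≠ 0}

variable {V} in
theorem supp_add_subset (s t : ∀ x, V x) : supp (s + t) ⊆ supp s ∪ supp t := by
  rw [supp, supp, supp, ← closure_union]
  refine closure_mono fun x hx => ?_
  by_contra h
  simp only [mem_union, Set.mem_ofPred_eq, not_or, not_not] at h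
  exact hx (by simp [h.1, h.2])

variable {V} in
theorem supp_smul_subset (c : ℂ) (s : ∀ x, V x) : supp (c • s) ⊆ supp s := by
  refine closure_mono fun x hx h => hx ?_
  simp [h]

variable (M) in
theorem supp_zero : supp (0 : ∀ x, V x) = ∅ := by simp [supp]

/-- The space `Γ_c(M; V)` of compactly supported smooth sections. -/
def CSec : Submodule ℂ (Sec n F V) where
  carrier := {u | IsCompact (supp u.1)}
  add_mem' := fun {u v} hu hv =>
    (IsCompact.union hu hv).of_isClosed_subset isClosed_closure (supp_add_subset u.1 v.1)
  zero_mem' := by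
    change IsCompact (supp (0 : ∀ x, V x))
    rw [supp_zero]; exact isCompact_empty
  smul_mem' := fun c u hu =>
    IsCompact.of_isClosed_subset hu isClosed_closure (supp_smul_subset c u.1)

variable {n V F} in
theorem mul_mem_sec (f : C^∞⟮𝓡 n, M; 𝓘(ℝ, ℝ), ℝ⟯) (u : Sec n F V) :
    (fun x => ((f x : ℝ) : ℂ) • u.1 x) ∈ Sec n F V := by
  intro x₀
  have hu := (contMDiffAt_section x₀).1 (u.2 x₀)
  refine (contMDiffAt_section x₀).2
    (((f.contMDiff x₀).smul hu).congr_of_eventuallyEq ?_)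
  filter_upwards [(trivializationAt F V x₀).open_baseSet.mem_nhds
    (mem_baseSet_trivializationAt F V x₀)] with x hx
  exact ((trivializationAt F V x₀).linear ℂ hx).2 _ _

/-- Multiplication of sections by a smooth real function. -/
def mulSec (f : C^∞⟮𝓡 n, M; 𝓘(ℝ, ℝ), ℝ⟯) : Sec n F V →ₗ[ℂ] Sec n F V where
  toFun u := ⟨fun x => ((f x : ℝ) : ℂ) • u.1 x, mul_mem_sec f u⟩
  map_add' u v := by ext x; exact smul_add _ _ _
  map_smul' c u := by ext x; exact smul_comm _ _ _

end Sections

/-! ### Differential operators -/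

section DiffOp

variable {n : ℕ} {M : Type*} [TopologicalSpace M] [ChartedSpace (EuclideanSpace ℝ (Fin n)) M]
  {F : Type*} [NormedAddCommGroup F] [NormedSpace ℂ F]
  {V : M → Type*} [TopologicalSpace (TotalSpace F V)] [∀ x, AddCommGroup (V x)]
  [∀ x, Module ℂ (V x)] [∀ x, TopologicalSpace (V x)] [FiberBundle F V] [VectorBundle ℂ F V]
  {F' : Type*} [NormedAddCommGroup F'] [NormedSpace ℂ F']
  {W : M → Type*} [TopologicalSpace (TotalSpace F' W)] [∀ x, AddCommGroup (W x)]
  [∀ x, Module ℂ (W x)] [∀ x, TopologicalSpace (W x)] [FiberBundle F' W] [VectorBundle ℂ F' W]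

/-- `A : Γ(M; V) → Γ(M; W)` is a differential operator of order at most `m`: all its `(m+1)`-fold
iterated commutators with multiplications by smooth functions vanish. -/
def IsDiffOpOfOrder : ℕ → (Sec n F V →ₗ[ℂ] Sec n F' W) → Prop
  | 0, A => ∀ f : C^∞⟮𝓡 n, M; 𝓘(ℝ, ℝ), ℝ⟯, A ∘ₗ mulSec n F V f - mulSec n F' W f ∘ₗ A = 0
  | m + 1, A => ∀ f : C^∞⟮𝓡 n, M; 𝓘(ℝ, ℝ), ℝ⟯,
      IsDiffOpOfOrder m (A ∘ₗ mulSec n F V f - mulSec n F' W f ∘ₗ A)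

/-- `A ∈ Diff(M; V, W)`. -/
def IsDiffOp (A : Sec n F V →ₗ[ℂ] Sec n F' W) : Prop := ∃ m, IsDiffOpOfOrder m A

end DiffOp

/-! ### Lorentzian geometry -/

section Lorentz

variable (n : ℕ) (M : Type*) [TopologicalSpace M] [ChartedSpace (EuclideanSpace ℝ (Fin n)) M]
  [IsManifold (𝓡 n) ∞ M]

/-- A smooth Lorentzian metric of signature `(-, +, …, +)` together with a time orientation, given
by a continuous timelike vector field. -/
structure Spacetime where
  metric (x : M) : TangentSpace (𝓡 n) x →L[ℝ] TangentSpace (𝓡 n) x →L[ℝ] ℝ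
  symm (x : M) (v w : TangentSpace (𝓡 n) x) : metric x v w = metric x w v
  signature (x : M) : ∃ t : TangentSpace (𝓡 n) x, metric x t t < 0 ∧
    ∀ w : TangentSpace (𝓡 n) x, metric x t w = 0 → w ≠ 0 → 0 < metric x w w
  contMDiff : ContMDiff (𝓡 n)
    ((𝓡 n).prod 𝓘(ℝ, EuclideanSpace ℝ (Fin n) →L[ℝ] EuclideanSpace ℝ (Fin n) →L[ℝ] ℝ)) ∞
    (fun x : M => TotalSpace.mk'
      (EuclideanSpace ℝ (Fin n) →L[ℝ] EuclideanSpace ℝ (Fin n) →L[ℝ] ℝ)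
      (E := fun x : M => TangentSpace (𝓡 n) x →L[ℝ] TangentSpace (𝓡 n) x →L[ℝ] ℝ) x (metric x))
  timeField (x : M) : TangentSpace (𝓡 n) x
  timelike (x : M) : metric x (timeField x) (timeField x) < 0
  continuous_timeField : Continuous (fun x : M =>
    TotalSpace.mk' (EuclideanSpace ℝ (Fin n)) (E := fun x : M => TangentSpace (𝓡 n) x)
      x (timeField x))

/-- The two directions of time: `future` goes with retarded, `past` with advanced propagators. -/
inductive TimeDir
  | future
  | past

variable {n M}

namespace Spacetime

variable (S : Spacetime n M)

/-- Future-directed causal (timelike or lightlike, nonzero) tangent vectors. -/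
def IsFutureCausal (x : M) (v : TangentSpace (𝓡 n) x) : Prop :=
  v ≠ 0 ∧ S.metric x v v ≤ 0 ∧ S.metric x (S.timeField x) v < 0

/-- There is a future-directed causal `C¹` curve from `p` to `q`. -/
def CausalCurve (p q : M) : Prop :=
  ∃ γ : ℝ → M, γ 0 = p ∧ γ 1 = q ∧ ContMDiffOn 𝓘(ℝ, ℝ) (𝓡 n) 1 γ (Icc 0 1) ∧
    ∀ t ∈ Icc (0 : ℝ) 1,
      S.IsFutureCausal (γ t) (mfderivWithin 𝓘(ℝ, ℝ) (𝓡 n) γ (Icc 0 1) t (1 : ℝ))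

/-- `J⁺(A)` and `J⁻(A)`: the points that are reached from `A` by future-directed
(respectively past-directed) piecewise `C¹` causal curves, together with `A` itself. -/
def J : TimeDir → Set M → Set M
  | .future, A => {q | ∃ p ∈ A, Relation.ReflTransGen S.CausalCurve p q}
  | .past, A => {q | ∃ p ∈ A, Relation.ReflTransGen S.CausalCurve q p}

theorem J_mono (τ : TimeDir) {A B : Set M} (h : A ⊆ B) : S.J τ A ⊆ S.J τ B := by
  cases τ <;> exact fun q ⟨p, hp, hpq⟩ => ⟨p, h hp, hpq⟩

/-- Global hyperbolicity: there are no closed causal curves, and the causal diamonds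
`J⁺(p) ∩ J⁻(q)` are compact. -/
def GloballyHyperbolic : Prop :=
  (∀ p, ¬ Relation.TransGen S.CausalCurve p p) ∧
    ∀ p q, IsCompact (S.J .future {p} ∩ S.J .past {q})

end Spacetime

variable (n M) in
/-- A smooth partition of unity subordinate to the preferred charts. -/
def chartPartition [T2Space M] [SigmaCompactSpace M] :
    SmoothPartitionOfUnity M (𝓡 n) M univ :=
  (SmoothPartitionOfUnity.exists_isSubordinate_chartAt_source (I := 𝓡 n) M).choose

namespace Spacetime

variable (S : Spacetime n M)

/-- The `k`-th coordinate vector field of the chart at `i`, at the point with coordinates `y`. -/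
def coordVec (i : M) (y : EuclideanSpace ℝ (Fin n)) (k : Fin n) :
    TangentSpace (𝓡 n) ((extChartAt (𝓡 n) i).symm y) :=
  mfderiv 𝓘(ℝ, EuclideanSpace ℝ (Fin n)) (𝓡 n) (extChartAt (𝓡 n) i).symm y
    (EuclideanSpace.single k (1 : ℝ) : EuclideanSpace ℝ (Fin n))

/-- `√|det (g_jk)|` in the chart at `i`. -/
def density (i : M) (y : EuclideanSpace ℝ (Fin n)) : ℝ :=
  √|(Matrix.of fun j k : Fin n =>
    S.metric ((extChartAt (𝓡 n) i).symm y) (coordVec i y j) (coordVec i y k)).det|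

/-- The integral `∫_M f dVol_g` of a compactly supported continuous function, computed in charts
by means of a partition of unity. -/
def integral [T2Space M] [SigmaCompactSpace M] (f : M → ℂ) : ℂ :=
  ∑ᶠ i : M, ∫ y in (extChartAt (𝓡 n) i).target,
    ((chartPartition n M i ((extChartAt (𝓡 n) i).symm y) * S.density i y : ℝ) : ℂ) *
      f ((extChartAt (𝓡 n) i).symm y)

end Spacetime

end Lorentz

/-! ### Hermitian structures, formal adjoints and Green hyperbolic operators -/

section Hermitian

variable (n : ℕ) {M : Type*} [TopologicalSpace M] [ChartedSpace (EuclideanSpace ℝ (Fin n)) M]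
  (F : Type*) [NormedAddCommGroup F] [NormedSpace ℂ F]
  (V : M → Type*) [TopologicalSpace (TotalSpace F V)] [∀ x, AddCommGroup (V x)]
  [∀ x, Module ℂ (V x)] [∀ x, TopologicalSpace (V x)] [FiberBundle F V] [VectorBundle ℂ F V]

/-- A hermitian structure: a smooth family of nondegenerate (not necessarily positive) hermitian
forms on the fibres, antilinear in the first argument. -/
structure HermitianStructure where
  form (x : M) : V x →ₗ⋆[ℂ] V x →ₗ[ℂ] ℂ
  symm (x : M) (v w : V x) : (starRingEnd ℂ) (form x v w) = form x w v
  nondegenerate (x : M) (v : V x) (hv : ∀ w, form x v w = 0) : v = 0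
  contMDiff (u v : Sec n F V) :
    ContMDiff (𝓡 n) 𝓘(ℝ, ℂ) ∞ (fun x => form x (u.1 x) (v.1 x))

end Hermitian

section Green

variable {n : ℕ} {M : Type*} [TopologicalSpace M] [ChartedSpace (EuclideanSpace ℝ (Fin n)) M]
  [IsManifold (𝓡 n) ∞ M] [T2Space M] [SigmaCompactSpace M]
  {F : Type*} [NormedAddCommGroup F] [NormedSpace ℂ F]
  {V : M → Type*} [TopologicalSpace (TotalSpace F V)] [∀ x, AddCommGroup (V x)]
  [∀ x, Module ℂ (V x)] [∀ x, TopologicalSpace (V x)] [FiberBundle F V] [VectorBundle ℂ F V]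
  {F' : Type*} [NormedAddCommGroup F'] [NormedSpace ℂ F']
  {W : M → Type*} [TopologicalSpace (TotalSpace F' W)] [∀ x, AddCommGroup (W x)]
  [∀ x, Module ℂ (W x)] [∀ x, TopologicalSpace (W x)] [FiberBundle F' W] [VectorBundle ℂ F' W]
  (S : Spacetime n M)

/-- The pairing `(u|v)_V = ∫_M (u(x), v(x))_V dVol_g`. -/
def pairing (h : HermitianStructure n F V) (u v : Sec n F V) : ℂ :=
  S.integral fun x => h.form x (u.1 x) (v.1 x)

/-- `B` is a formal adjoint of `A`: `(B v|u)_V = (v|A u)_W` for compactly supported `u`, `v`. -/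
def IsFormalAdjoint (h : HermitianStructure n F V) (k : HermitianStructure n F' W)
    (A : Sec n F V →ₗ[ℂ] Sec n F' W) (B : Sec n F' W →ₗ[ℂ] Sec n F V) : Prop :=
  ∀ (u : CSec n F V) (v : CSec n F' W), pairing S h (B v) u = pairing S k v (A u)

open Classical in
/-- The formal adjoint `A*` of a differential operator `A`, i.e. the differential operator that
is a formal adjoint of `A`. It exists and is unique, so that the value `0` never occurs for
differential operators `A`. -/
def formalAdjoint (h : HermitianStructure n F V) (k : HermitianStructure n F' W)
    (A : Sec n F V →ₗ[ℂ] Sec n F' W) : Sec n F' W →ₗ[ℂ] Sec n F V :=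
  if hB : ∃ B, IsDiffOp B ∧ IsFormalAdjoint S h k A B then hB.choose else 0

/-- `G : Γ_c → Γ` is the retarded (`τ = future`) or advanced (`τ = past`) propagator of `D`. -/
structure IsPropagator (τ : TimeDir) (D : Sec n F V →ₗ[ℂ] Sec n F V)
    (G : CSec n F V →ₗ[ℂ] Sec n F V) : Prop where
  right_inv (u : CSec n F V) : D (G u) = u
  left_inv (u : CSec n F V) (hu : D u ∈ CSec n F V) : G ⟨D u, hu⟩ = u
  supp_subset (u : CSec n F V) : supp (G u).1 ⊆ S.J τ (supp u.1.1)

/-- A differential operator `D` is Green hyperbolic if `D` and `D*` have retarded and advanced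
propagators. -/
structure GreenHyperbolic (h : HermitianStructure n F V) (D : Sec n F V →ₗ[ℂ] Sec n F V) :
    Prop where
  isDiffOp : IsDiffOp D
  propagator (τ : TimeDir) : ∃ G, IsPropagator S τ D G
  propagator_adjoint (τ : TimeDir) : ∃ G, IsPropagator S τ (formalAdjoint S h h D) G

variable (F V) in
/-- The smooth sections with support in `J^±(C)` for some compact set `C`. -/
def CausalSec (τ : TimeDir) : Submodule ℂ (Sec n F V) where
  carrier := {u | ∃ C, IsCompact C ∧ supp u.1 ⊆ S.J τ C}
  add_mem' := by
    rintro u v ⟨C, hC, hu⟩ ⟨C', hC', hv⟩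
    exact ⟨C ∪ C', hC.union hC', (supp_add_subset u.1 v.1).trans (union_subset
      (hu.trans (S.J_mono τ subset_union_left)) (hv.trans (S.J_mono τ subset_union_right)))⟩
  zero_mem' := ⟨∅, isCompact_empty, by
    change supp (0 : ∀ x, V x) ⊆ _
    rw [supp_zero]; exact empty_subset _⟩
  smul_mem' := by
    rintro c u ⟨C, hC, hu⟩
    exact ⟨C, hC, (supp_smul_subset c u.1).trans hu⟩

/-- `Gx` is the extension of the propagator `G` of `D` from compactly supported sections to
sections with support in `J^±(C)`, `C` compact. -/
structure IsExtendedPropagator (τ : TimeDir) (D : Sec n F V →ₗ[ℂ] Sec n F V)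
    (G : CSec n F V →ₗ[ℂ] Sec n F V) (Gx : CausalSec F V S τ →ₗ[ℂ] CausalSec F V S τ) :
    Prop where
  extends_propagator (u : CSec n F V) (w : CausalSec F V S τ) (hw : (w : Sec n F V) = u) :
    (Gx w : Sec n F V) = G u
  right_inv (w : CausalSec F V S τ) : D (Gx w) = w
  left_inv (w : CausalSec F V S τ) (hw : D w ∈ CausalSec F V S τ) : Gx ⟨D w, hw⟩ = w
  supp_subset (w : CausalSec F V S τ) : supp (Gx w).1.1 ⊆ S.J τ (supp w.1.1)

end Green

/-! ### Direct sums -/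

section DirectSum

variable {n : ℕ} {M : Type*} [TopologicalSpace M] [ChartedSpace (EuclideanSpace ℝ (Fin n)) M]
  {F : Type*} [NormedAddCommGroup F] [NormedSpace ℂ F]
  {V : M → Type*} [TopologicalSpace (TotalSpace F V)] [∀ x, AddCommGroup (V x)]
  [∀ x, Module ℂ (V x)] [∀ x, TopologicalSpace (V x)] [FiberBundle F V] [VectorBundle ℂ F V]
  {F' : Type*} [NormedAddCommGroup F'] [NormedSpace ℂ F']
  {W : M → Type*} [TopologicalSpace (TotalSpace F' W)] [∀ x, AddCommGroup (W x)]
  [∀ x, Module ℂ (W x)] [∀ x, TopologicalSpace (W x)] [FiberBundle F' W] [VectorBundle ℂ F' W]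

/-- First component of a section of `V ⊕ W`. -/
def fstSec : Sec n (F × F') (V ×ᵇ W) →ₗ[ℂ] Sec n F V where
  toFun u := ⟨fun x => (u.1 x).1, fun x₀ => (contMDiffAt_section x₀).2 (by
    have hu := (contMDiffAt_section x₀).1 (u.2 x₀)
    exact (contDiff_fst (𝕜 := ℝ) (E := F) (F := F')).contMDiff.contMDiffAt.comp x₀ hu)⟩
  map_add' _ _ := rfl
  map_smul' _ _ := rfl

/-- Second component of a section of `V ⊕ W`. -/
def sndSec : Sec n (F × F') (V ×ᵇ W) →ₗ[ℂ] Sec n F' W where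
  toFun u := ⟨fun x => (u.1 x).2, fun x₀ => (contMDiffAt_section x₀).2 (by
    have hu := (contMDiffAt_section x₀).1 (u.2 x₀)
    exact (contDiff_snd (𝕜 := ℝ) (E := F) (F := F')).contMDiff.contMDiffAt.comp x₀ hu)⟩
  map_add' _ _ := rfl
  map_smul' _ _ := rfl

/-- The section of `V ⊕ W` with given components. -/
def pairSec : Sec n F V × Sec n F' W →ₗ[ℂ] Sec n (F × F') (V ×ᵇ W) where
  toFun u := ⟨fun x => (u.1.1 x, u.2.1 x), fun x₀ => (contMDiffAt_section x₀).2 (by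
    have h1 := (contMDiffAt_section x₀).1 (u.1.2 x₀)
    have h2 := (contMDiffAt_section x₀).1 (u.2.2 x₀)
    exact h1.prodMk_space h2)⟩
  map_add' _ _ := rfl
  map_smul' _ _ := rfl

/-- First component of a compactly supported section of `V ⊕ W`. -/
def fstCSec : CSec n (F × F') (V ×ᵇ W) →ₗ[ℂ] CSec n F V :=
  (fstSec ∘ₗ (CSec n (F × F') (V ×ᵇ W)).subtype).codRestrict _ fun u =>
    IsCompact.of_isClosed_subset u.2 isClosed_closure
      (closure_mono fun _ hx h => hx (congrArg Prod.fst h))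

/-- Second component of a compactly supported section of `V ⊕ W`. -/
def sndCSec : CSec n (F × F') (V ×ᵇ W) →ₗ[ℂ] CSec n F' W :=
  (sndSec ∘ₗ (CSec n (F × F') (V ×ᵇ W)).subtype).codRestrict _ fun u =>
    IsCompact.of_isClosed_subset u.2 isClosed_closure
      (closure_mono fun _ hx h => hx (congrArg Prod.snd h))

/-- The orthogonal direct sum of hermitian structures. -/
def HermitianStructure.prod (h : HermitianStructure n F V) (k : HermitianStructure n F' W) :
    HermitianStructure n (F × F') (V ×ᵇ W) where
  form x := LinearMap.mk₂'ₛₗ (starRingEnd ℂ) (RingHom.id ℂ)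
    (fun v w : V x × W x => h.form x v.1 w.1 + k.form x v.2 w.2)
    (fun v v' w => by simp; ring) (fun c v w => by simp; ring)
    (fun v w w' => by simp; ring) (fun c v w => by simp; ring)
  symm x v w := by simp [h.symm, k.symm]
  nondegenerate x v hv := by
    refine Prod.ext (h.nondegenerate x _ fun w => ?_) (k.nondegenerate x _ fun w => ?_)
    · simpa using hv (w, 0)
    · simpa using hv (0, w)
  contMDiff u v := (h.contMDiff (fstSec u) (fstSec v)).add (k.contMDiff (sndSec u) (sndSec v))

end DirectSum

/-! ### The operators and hypotheses of linear gauge theory -/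

section Gauge

variable {n : ℕ} {M : Type*} [TopologicalSpace M] [ChartedSpace (EuclideanSpace ℝ (Fin n)) M]
  {F₀ : Type*} [NormedAddCommGroup F₀] [NormedSpace ℂ F₀]
  {V₀ : M → Type*} [TopologicalSpace (TotalSpace F₀ V₀)] [∀ x, AddCommGroup (V₀ x)]
  [∀ x, Module ℂ (V₀ x)] [∀ x, TopologicalSpace (V₀ x)] [FiberBundle F₀ V₀] [VectorBundle ℂ F₀ V₀]
  {F₁ : Type*} [NormedAddCommGroup F₁] [NormedSpace ℂ F₁]
  {V₁ : M → Type*} [TopologicalSpace (TotalSpace F₁ V₁)] [∀ x, AddCommGroup (V₁ x)]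
  [∀ x, Module ℂ (V₁ x)] [∀ x, TopologicalSpace (V₁ x)] [FiberBundle F₁ V₁] [VectorBundle ℂ F₁ V₁]

variable (n F₀ V₀ F₁ V₁) in
/-- Sections of `V₁ ⊕ V₀ ⊕ V₀ ⊕ V₀`. -/
abbrev GaugeSec := Sec n (F₁ × F₀ × F₀ × F₀) (V₁ ×ᵇ (V₀ ×ᵇ (V₀ ×ᵇ V₀)))

variable (n F₀ V₀ F₁ V₁) in
/-- Compactly supported sections of `V₁ ⊕ V₀ ⊕ V₀ ⊕ V₀`. -/
abbrev GaugeCSec := CSec n (F₁ × F₀ × F₀ × F₀) (V₁ ×ᵇ (V₀ ×ᵇ (V₀ ×ᵇ V₀)))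

/-- The four components of a section of `V₁ ⊕ V₀ ⊕ V₀ ⊕ V₀`. -/
def compA : GaugeSec n F₀ V₀ F₁ V₁ →ₗ[ℂ] Sec n F₁ V₁ := fstSec
def compB : GaugeSec n F₀ V₀ F₁ V₁ →ₗ[ℂ] Sec n F₀ V₀ := fstSec ∘ₗ sndSec
def compC : GaugeSec n F₀ V₀ F₁ V₁ →ₗ[ℂ] Sec n F₀ V₀ := fstSec ∘ₗ sndSec ∘ₗ sndSec
def compD : GaugeSec n F₀ V₀ F₁ V₁ →ₗ[ℂ] Sec n F₀ V₀ := sndSec ∘ₗ sndSec ∘ₗ sndSec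

/-- The operator
`L = ((P, K, 0, 0), (K*, -α, 0, 0), (0, 0, 0, K*K), (0, 0, K*K, 0))` on sections of
`V₁ ⊕ V₀ ⊕ V₀ ⊕ V₀`; the argument `Ks` stands for `K*`. -/
def blockOperator (P : Sec n F₁ V₁ →ₗ[ℂ] Sec n F₁ V₁) (K : Sec n F₀ V₀ →ₗ[ℂ] Sec n F₁ V₁)
    (Ks : Sec n F₁ V₁ →ₗ[ℂ] Sec n F₀ V₀) (α : ℝ) :
    GaugeSec n F₀ V₀ F₁ V₁ →ₗ[ℂ] GaugeSec n F₀ V₀ F₁ V₁ :=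
  pairSec ∘ₗ (P ∘ₗ compA + K ∘ₗ compB).prod
    (pairSec ∘ₗ (Ks ∘ₗ compA - (α : ℂ) • compB).prod
      (pairSec ∘ₗ (Ks ∘ₗ K ∘ₗ compD).prod (Ks ∘ₗ K ∘ₗ compC)))

/-- The hermitian structure of `V₁ ⊕ V₀ ⊕ V₀ ⊕ V₀`. -/
abbrev gaugeHermitian (h₀ : HermitianStructure n F₀ V₀) (h₁ : HermitianStructure n F₁ V₁) :
    HermitianStructure n (F₁ × F₀ × F₀ × F₀) (V₁ ×ᵇ (V₀ ×ᵇ (V₀ ×ᵇ V₀))) :=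
  h₁.prod (h₀.prod (h₀.prod h₀))

variable [IsManifold (𝓡 n) ∞ M] [T2Space M] [SigmaCompactSpace M]

/-- The data of a linear gauge theory in the subsidiary condition framework (Hack–Schenkel). -/
structure SubsidiaryHypothesis (S : Spacetime n M) (h₀ : HermitianStructure n F₀ V₀)
    (h₁ : HermitianStructure n F₁ V₁) (P : Sec n F₁ V₁ →ₗ[ℂ] Sec n F₁ V₁)
    (K T : Sec n F₀ V₀ →ₗ[ℂ] Sec n F₁ V₁) : Prop where
  isDiffOp_P : IsDiffOp P
  selfAdjoint_P : IsFormalAdjoint S h₁ h₁ P P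
  isDiffOp_K : IsDiffOp K
  K_ne_zero : K ≠ 0
  P_comp_K : P ∘ₗ K = 0
  greenHyperbolic_R : GreenHyperbolic S h₀ (formalAdjoint S h₀ h₁ K ∘ₗ K)
  isDiffOp_T : IsDiffOp T
  greenHyperbolic_D : GreenHyperbolic S h₁ (P + T ∘ₗ formalAdjoint S h₀ h₁ K)
  greenHyperbolic_Q : GreenHyperbolic S h₀ (formalAdjoint S h₀ h₁ K ∘ₗ T)

/-- The modified assumptions, which require Green hyperbolicity of the block operator `L`. -/
structure BlockHypothesis (S : Spacetime n M) (h₀ : HermitianStructure n F₀ V₀)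
    (h₁ : HermitianStructure n F₁ V₁) (P : Sec n F₁ V₁ →ₗ[ℂ] Sec n F₁ V₁)
    (K : Sec n F₀ V₀ →ₗ[ℂ] Sec n F₁ V₁) (α : ℝ) : Prop where
  isDiffOp_P : IsDiffOp P
  selfAdjoint_P : IsFormalAdjoint S h₁ h₁ P P
  isDiffOp_K : IsDiffOp K
  K_ne_zero : K ≠ 0
  P_comp_K : P ∘ₗ K = 0
  greenHyperbolic_L : GreenHyperbolic S (gaugeHermitian h₀ h₁)
    (blockOperator P K (formalAdjoint S h₀ h₁ K) α)

/-- `G_L` is the block matrix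
`((G_D (1 + (α - 1) K K* G_D), K G_Q, 0, 0), (K* G_D, 0, 0, 0), (0, 0, 0, G_Q), (0, 0, G_Q, 0))`
acting on compactly supported sections of `V₁ ⊕ V₀ ⊕ V₀ ⊕ V₀`. The outer `G_D` in the first
entry acts on a section whose support is in general not compact, so it is the extension `G_Dx`
of the propagator `G_D`. -/
def IsBlockPropagator (S : Spacetime n M) (τ : TimeDir)
    (K : Sec n F₀ V₀ →ₗ[ℂ] Sec n F₁ V₁) (Ks : Sec n F₁ V₁ →ₗ[ℂ] Sec n F₀ V₀) (α : ℝ)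
    (G_D : CSec n F₁ V₁ →ₗ[ℂ] Sec n F₁ V₁)
    (G_Dx : CausalSec F₁ V₁ S τ →ₗ[ℂ] CausalSec F₁ V₁ S τ)
    (G_Q : CSec n F₀ V₀ →ₗ[ℂ] Sec n F₀ V₀)
    (G_L : GaugeCSec n F₀ V₀ F₁ V₁ →ₗ[ℂ] GaugeSec n F₀ V₀ F₁ V₁) : Prop :=
  ∀ f : GaugeCSec n F₀ V₀ F₁ V₁,
    let fa : CSec n F₁ V₁ := fstCSec f
    let fb : CSec n F₀ V₀ := fstCSec (sndCSec f)
    let fc : CSec n F₀ V₀ := fstCSec (sndCSec (sndCSec f))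
    let fd : CSec n F₀ V₀ := sndCSec (sndCSec (sndCSec f))
    (∃ w : CausalSec F₁ V₁ S τ,
      (w : Sec n F₁ V₁) = (fa : Sec n F₁ V₁) + ((α : ℂ) - 1) • K (Ks (G_D fa)) ∧
      compA (G_L f) = (G_Dx w : Sec n F₁ V₁) + K (G_Q fb)) ∧
    compB (G_L f) = Ks (G_D fa) ∧
    compC (G_L f) = G_Q fd ∧
    compD (G_L f) = G_Q fc

end Gauge

end GreenHyp

end

/-! Write `K*` for the adjoint. Taking adjoints in `PK = 0` gives `K*P = 0`, hence `K*D = QK*`. This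
intertwining relation drives all the algebra.

Uniqueness. Let `L(a, b, c, d) = 0` with supports in `J^±(C)`. The last two rows read `Qd = 0` and
`Qc = 0`. Applying `K*` to `Pa + Kb = 0` gives `Qb = 0`. As `Q` is injective on such sections, `b =
c = d = 0`; then `K*a = αb = 0` and `Pa = 0`, so `Da = 0` and `a = 0`
(`blockOperator_injOn_causalSec`).

Existence. Put `X = G_D f` and `Z = G_D(f + (α-1)KK*X)`. Then `QK*X = K*f` and `QK*Z = K*f +
(α-1)QK*X = αQK*X`, so `K*Z = αK*X` and `PZ = f - KK*X`. These identities say that the proposed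
matrix is a right inverse of `L` (`IsBlockPropagator.isPropagator`). It is a left inverse by
injectivity, and the only propagator for the same reason. Since `L` is formally self-adjoint, `L* =
L` and nothing more has to be shown for the adjoint.

The analytic input is the extension of a propagator `G` from compact supports to supports in
`J^±(C)` (`IsPropagator.extend`). By global hyperbolicity, the part of `J^±(C)` that can influence
points near `x` lies in a compact set (`GloballyHyperbolic.exists_isCompact_superset`). So `Gw` near
`x` is defined as `G(fw)` for a cutoff `f` equal to one near that set, and the support property of
`G` makes the choice of `f` immaterial. The locality of differential operators, defined here by
iterated commutators, transfers the inverse relations from `G` to its extension.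

Identifying `L*` with `L` requires uniqueness of formal adjoints, that is, nondegeneracy of the
pairing: positivity of the volume density, together with enough smooth sections. Existence of `K*`
is extracted from the hypotheses: the default value zero of `formalAdjoint` would make `Q = 0`,
which is incompatible with a propagator of `Q` and `K ≠ 0`. -/

namespace GreenHyp

/-! ### Algebra of differential operators defined by iterated commutators -/

section DiffOpAlgebra

variable {n : ℕ} {M : Type*} [TopologicalSpace M] [ChartedSpace (EuclideanSpace ℝ (Fin n)) M]
  {F : Type*} [NormedAddCommGroup F] [NormedSpace ℂ F]
  {V : M → Type*} [TopologicalSpace (TotalSpace F V)] [∀ x, AddCommGroup (V x)]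
  [∀ x, Module ℂ (V x)] [∀ x, TopologicalSpace (V x)] [FiberBundle F V] [VectorBundle ℂ F V]
  {F' : Type*} [NormedAddCommGroup F'] [NormedSpace ℂ F']
  {W : M → Type*} [TopologicalSpace (TotalSpace F' W)] [∀ x, AddCommGroup (W x)]
  [∀ x, Module ℂ (W x)] [∀ x, TopologicalSpace (W x)] [FiberBundle F' W] [VectorBundle ℂ F' W]
  {F'' : Type*} [NormedAddCommGroup F''] [NormedSpace ℂ F'']
  {X : M → Type*} [TopologicalSpace (TotalSpace F'' X)] [∀ x, AddCommGroup (X x)]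
  [∀ x, Module ℂ (X x)] [∀ x, TopologicalSpace (X x)] [FiberBundle F'' X] [VectorBundle ℂ F'' X]

/-- The commutator of an operator with multiplication by a smooth function. -/
noncomputable def commMul (A : Sec n F V →ₗ[ℂ] Sec n F' W) (f : C^∞⟮𝓡 n, M; 𝓘(ℝ, ℝ), ℝ⟯) :
    Sec n F V →ₗ[ℂ] Sec n F' W :=
  A ∘ₗ mulSec n F V f - mulSec n F' W f ∘ₗ A

theorem commMul_add (A B : Sec n F V →ₗ[ℂ] Sec n F' W) (f : C^∞⟮𝓡 n, M; 𝓘(ℝ, ℝ), ℝ⟯) :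
    commMul (A + B) f = commMul A f + commMul B f := by
  simp only [commMul, LinearMap.add_comp, LinearMap.comp_add]; abel

theorem commMul_smul (c : ℂ) (A : Sec n F V →ₗ[ℂ] Sec n F' W)
    (f : C^∞⟮𝓡 n, M; 𝓘(ℝ, ℝ), ℝ⟯) : commMul (c • A) f = c • commMul A f := by
  simp only [commMul, LinearMap.smul_comp, LinearMap.comp_smul]; module

/-- The Leibniz rule for commutators, on which the order count for compositions rests. -/
theorem commMul_comp (A : Sec n F' W →ₗ[ℂ] Sec n F'' X) (B : Sec n F V →ₗ[ℂ] Sec n F' W)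
    (f : C^∞⟮𝓡 n, M; 𝓘(ℝ, ℝ), ℝ⟯) :
    commMul (A ∘ₗ B) f = A ∘ₗ commMul B f + commMul A f ∘ₗ B := by
  simp only [commMul, LinearMap.comp_sub, LinearMap.sub_comp, LinearMap.comp_assoc]; abel

theorem commMul_zero (f : C^∞⟮𝓡 n, M; 𝓘(ℝ, ℝ), ℝ⟯) :
    commMul (0 : Sec n F V →ₗ[ℂ] Sec n F' W) f = 0 := by
  simp only [commMul, LinearMap.zero_comp, LinearMap.comp_zero]; abel

theorem IsDiffOp.of_commute {A : Sec n F V →ₗ[ℂ] Sec n F' W}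
    (h : ∀ (f : C^∞⟮𝓡 n, M; 𝓘(ℝ, ℝ), ℝ⟯) (u : Sec n F V),
      A (mulSec n F V f u) = mulSec n F' W f (A u)) : IsDiffOp A := by
  refine ⟨0, fun f => ?_⟩
  have : A ∘ₗ mulSec n F V f = mulSec n F' W f ∘ₗ A := LinearMap.ext (h f)
  rw [this]; abel

theorem isDiffOpOfOrder_zero_op :
    ∀ m, IsDiffOpOfOrder m (0 : Sec n F V →ₗ[ℂ] Sec n F' W)
  | 0 => fun f => commMul_zero f
  | m + 1 => fun f => by
      change IsDiffOpOfOrder m (commMul (0 : Sec n F V →ₗ[ℂ] Sec n F' W) f)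
      rw [commMul_zero]
      exact isDiffOpOfOrder_zero_op m

theorem IsDiffOpOfOrder.succ :
    ∀ {m : ℕ} {A : Sec n F V →ₗ[ℂ] Sec n F' W}, IsDiffOpOfOrder m A → IsDiffOpOfOrder (m + 1) A
  | 0, _, h => fun f => by rw [h f]; exact isDiffOpOfOrder_zero_op 0
  | _ + 1, _, h => fun f => (h f).succ

theorem IsDiffOpOfOrder.mono {m k : ℕ} (hmk : m ≤ k) {A : Sec n F V →ₗ[ℂ] Sec n F' W}
    (h : IsDiffOpOfOrder m A) : IsDiffOpOfOrder k A := by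
  induction k, hmk using Nat.le_induction with
  | base => exact h
  | succ k _ ih => exact ih.succ

theorem IsDiffOpOfOrder.add :
    ∀ {m : ℕ} {A B : Sec n F V →ₗ[ℂ] Sec n F' W},
      IsDiffOpOfOrder m A → IsDiffOpOfOrder m B → IsDiffOpOfOrder m (A + B)
  | 0, A, B, hA, hB => fun f => by
      change commMul (A + B) f = 0
      rw [commMul_add, commMul, commMul, hA f, hB f, add_zero]
  | m + 1, A, B, hA, hB => fun f => by
      change IsDiffOpOfOrder m (commMul (A + B) f)
      rw [commMul_add]
      exact (hA f).add (hB f)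

theorem IsDiffOpOfOrder.smul (c : ℂ) :
    ∀ {m : ℕ} {A : Sec n F V →ₗ[ℂ] Sec n F' W}, IsDiffOpOfOrder m A → IsDiffOpOfOrder m (c • A)
  | 0, A, hA => fun f => by
      change commMul (c • A) f = 0
      rw [commMul_smul, commMul, hA f, smul_zero]
  | m + 1, A, hA => fun f => by
      change IsDiffOpOfOrder m (commMul (c • A) f)
      rw [commMul_smul]
      exact (hA f).smul c

/-- Induction on the total order `m + k`: by the Leibniz rule a commutator lowers the order of one
factor, and it annihilates a factor of order zero. -/
theorem IsDiffOpOfOrder.comp {m k : ℕ} {A : Sec n F' W →ₗ[ℂ] Sec n F'' X}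
    {B : Sec n F V →ₗ[ℂ] Sec n F' W} (hA : IsDiffOpOfOrder m A) (hB : IsDiffOpOfOrder k B) :
    IsDiffOpOfOrder (m + k) (A ∘ₗ B) := by
  induction hs : m + k generalizing m k A B with
  | zero =>
    obtain ⟨rfl, rfl⟩ : m = 0 ∧ k = 0 := by omega
    intro f
    change commMul (A ∘ₗ B) f = 0
    rw [commMul_comp, commMul, commMul, hA f, hB f]; simp
  | succ s ih =>
    intro f
    change IsDiffOpOfOrder s (commMul (A ∘ₗ B) f)
    rw [commMul_comp]
    refine IsDiffOpOfOrder.add ?_ ?_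
    · cases k with
      | zero =>
        rw [commMul, hB f, LinearMap.comp_zero]
        exact isDiffOpOfOrder_zero_op _
      | succ k => exact ih hA (hB f) (by omega)
    · cases m with
      | zero =>
        rw [commMul, hA f, LinearMap.zero_comp]
        exact isDiffOpOfOrder_zero_op _
      | succ m => exact ih (hA f) hB (by omega)

theorem isDiffOp_zero : IsDiffOp (0 : Sec n F V →ₗ[ℂ] Sec n F' W) :=
  ⟨0, isDiffOpOfOrder_zero_op 0⟩

theorem IsDiffOp.add {A B : Sec n F V →ₗ[ℂ] Sec n F' W} (hA : IsDiffOp A) (hB : IsDiffOp B) :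
    IsDiffOp (A + B) := by
  obtain ⟨m, hm⟩ := hA
  obtain ⟨k, hk⟩ := hB
  exact ⟨max m k, (hm.mono (le_max_left _ _)).add (hk.mono (le_max_right _ _))⟩

theorem IsDiffOp.smul (c : ℂ) {A : Sec n F V →ₗ[ℂ] Sec n F' W} (hA : IsDiffOp A) :
    IsDiffOp (c • A) := hA.imp fun _ h => h.smul c

theorem IsDiffOp.sub {A B : Sec n F V →ₗ[ℂ] Sec n F' W} (hA : IsDiffOp A) (hB : IsDiffOp B) :
    IsDiffOp (A - B) := by
  have : A - B = A + (-1 : ℂ) • B := by module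
  rw [this]
  exact hA.add (hB.smul _)

theorem IsDiffOp.comp {A : Sec n F' W →ₗ[ℂ] Sec n F'' X} {B : Sec n F V →ₗ[ℂ] Sec n F' W}
    (hA : IsDiffOp A) (hB : IsDiffOp B) : IsDiffOp (A ∘ₗ B) := by
  obtain ⟨m, hm⟩ := hA
  obtain ⟨k, hk⟩ := hB
  exact ⟨m + k, hm.comp hk⟩

theorem isDiffOp_fstSec : IsDiffOp (fstSec : Sec n (F × F') (V ×ᵇ W) →ₗ[ℂ] Sec n F V) :=
  IsDiffOp.of_commute fun _ _ => rfl

theorem isDiffOp_sndSec : IsDiffOp (sndSec : Sec n (F × F') (V ×ᵇ W) →ₗ[ℂ] Sec n F' W) :=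
  IsDiffOp.of_commute fun _ _ => rfl

/-- The inclusion of sections of `V` into sections of `V ⊕ W`. -/
noncomputable def inlSec : Sec n F V →ₗ[ℂ] Sec n (F × F') (V ×ᵇ W) := pairSec ∘ₗ LinearMap.inl ℂ _ _

/-- The inclusion of sections of `W` into sections of `V ⊕ W`. -/
noncomputable def inrSec : Sec n F' W →ₗ[ℂ] Sec n (F × F') (V ×ᵇ W) := pairSec ∘ₗ LinearMap.inr ℂ _ _

theorem isDiffOp_inlSec : IsDiffOp (inlSec : Sec n F V →ₗ[ℂ] Sec n (F × F') (V ×ᵇ W)) := by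
  refine IsDiffOp.of_commute fun f u => ?_
  ext x
  · rfl
  · exact (smul_zero (A := W x) ((f x : ℝ) : ℂ)).symm

theorem isDiffOp_inrSec : IsDiffOp (inrSec : Sec n F' W →ₗ[ℂ] Sec n (F × F') (V ×ᵇ W)) := by
  refine IsDiffOp.of_commute fun f u => ?_
  ext x
  · exact (smul_zero (A := V x) ((f x : ℝ) : ℂ)).symm
  · rfl

theorem pairSec_comp_prod (A : Sec n F'' X →ₗ[ℂ] Sec n F V) (B : Sec n F'' X →ₗ[ℂ] Sec n F' W) :
    pairSec ∘ₗ A.prod B = inlSec ∘ₗ A + inrSec ∘ₗ B := by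
  refine LinearMap.ext fun u => ?_
  change pairSec (A u, B u) = pairSec (A u, 0) + pairSec (0, B u)
  rw [← map_add]; simp

theorem IsDiffOp.pair {A : Sec n F'' X →ₗ[ℂ] Sec n F V} {B : Sec n F'' X →ₗ[ℂ] Sec n F' W}
    (hA : IsDiffOp A) (hB : IsDiffOp B) : IsDiffOp (pairSec ∘ₗ A.prod B) := by
  rw [pairSec_comp_prod]
  exact (isDiffOp_inlSec.comp hA).add (isDiffOp_inrSec.comp hB)

theorem isDiffOp_compA : IsDiffOp (compA : GaugeSec n F V F' W →ₗ[ℂ] _) := isDiffOp_fstSec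

theorem isDiffOp_compB : IsDiffOp (compB : GaugeSec n F V F' W →ₗ[ℂ] _) :=
  isDiffOp_fstSec.comp isDiffOp_sndSec

theorem isDiffOp_compC : IsDiffOp (compC : GaugeSec n F V F' W →ₗ[ℂ] _) :=
  isDiffOp_fstSec.comp (isDiffOp_sndSec.comp isDiffOp_sndSec)

theorem isDiffOp_compD : IsDiffOp (compD : GaugeSec n F V F' W →ₗ[ℂ] _) :=
  isDiffOp_sndSec.comp (isDiffOp_sndSec.comp isDiffOp_sndSec)

theorem isDiffOp_blockOperator {P : Sec n F' W →ₗ[ℂ] Sec n F' W} {K : Sec n F V →ₗ[ℂ] Sec n F' W}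
    {Ks : Sec n F' W →ₗ[ℂ] Sec n F V} (hP : IsDiffOp P) (hK : IsDiffOp K) (hKs : IsDiffOp Ks)
    (α : ℝ) : IsDiffOp (blockOperator P K Ks α) := by
  exact ((hP.comp isDiffOp_compA).add (hK.comp isDiffOp_compB)).pair
    (((hKs.comp isDiffOp_compA).sub (isDiffOp_compB.smul _)).pair
      ((hKs.comp (hK.comp isDiffOp_compD)).pair (hKs.comp (hK.comp isDiffOp_compC))))

end DiffOpAlgebra

/-! ### Supports of sections -/

section Support

variable {M : Type*} [TopologicalSpace M] {V : M → Type*} [∀ x, AddCommGroup (V x)]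

theorem notMem_supp_iff {s : ∀ x, V x} {x : M} : x ∉ supp s ↔ ∀ᶠ y in 𝓝 x, s y = 0 := by
  rw [supp, mem_closure_iff_frequently, not_frequently]
  simp

theorem eq_zero_of_notMem_supp {s : ∀ x, V x} {x : M} (h : x ∉ supp s) : s x = 0 :=
  (notMem_supp_iff.1 h).self_of_nhds

theorem isClosed_supp (s : ∀ x, V x) : IsClosed (supp s) := isClosed_closure

theorem supp_sub_subset (s t : ∀ x, V x) : supp (s - t) ⊆ supp s ∪ supp t := by
  intro x hx
  by_contra h
  simp only [mem_union, not_or, notMem_supp_iff] at h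
  refine notMem_supp_iff.2 ?_ hx
  filter_upwards [h.1, h.2] with y h1 h2
  simp [h1, h2]

end Support

/-! ### Cutoff functions and locality of differential operators -/

section Locality

variable {n : ℕ} {M : Type*} [TopologicalSpace M] [ChartedSpace (EuclideanSpace ℝ (Fin n)) M]
  [IsManifold (𝓡 n) ∞ M] [T2Space M] [SigmaCompactSpace M]
  {F : Type*} [NormedAddCommGroup F] [NormedSpace ℂ F]
  {V : M → Type*} [TopologicalSpace (TotalSpace F V)] [∀ x, AddCommGroup (V x)]
  [∀ x, Module ℂ (V x)] [∀ x, TopologicalSpace (V x)] [FiberBundle F V] [VectorBundle ℂ F V]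
  {F' : Type*} [NormedAddCommGroup F'] [NormedSpace ℂ F']
  {W : M → Type*} [TopologicalSpace (TotalSpace F' W)] [∀ x, AddCommGroup (W x)]
  [∀ x, Module ℂ (W x)] [∀ x, TopologicalSpace (W x)] [FiberBundle F' W] [VectorBundle ℂ F' W]

/-- Smooth cutoff functions: equal to one near the compact set `Z`, with support in a compact
subset of the open set `U`. -/
theorem exists_cutoff {Z U : Set M} (hZ : IsCompact Z) (hU : IsOpen U) (hZU : Z ⊆ U) :
    ∃ f : C^∞⟮𝓡 n, M; 𝓘(ℝ, ℝ), ℝ⟯, (∀ᶠ x in 𝓝ˢ Z, f x = 1) ∧ IsCompact (tsupport f) ∧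
      tsupport f ⊆ U ∧ ∀ x, f x ∈ Icc (0 : ℝ) 1 := by
  have : LocallyCompactSpace M := Manifold.locallyCompact_of_finiteDimensional (𝓡 n)
  obtain ⟨L, hL, hZL, hLU⟩ := exists_compact_between hZ hU hZU
  obtain ⟨f, hf1, hf0, hf⟩ := exists_contMDiffMap_one_nhds_of_subset_interior (n := ⊤) (𝓡 n)
    hZ.isClosed hZL
  have hs : tsupport f ⊆ L := closure_minimal
    (fun x hx => by_contra fun h => hx (hf0 x h)) hL.isClosed
  exact ⟨f, hf1, hL.of_isClosed_subset (isClosed_tsupport _) hs, hs.trans hLU, hf⟩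

theorem mulSec_apply (f : C^∞⟮𝓡 n, M; 𝓘(ℝ, ℝ), ℝ⟯) (u : Sec n F V) (x : M) :
    (mulSec n F V f u).1 x = ((f x : ℝ) : ℂ) • u.1 x := rfl

theorem supp_mulSec_subset_left (f : C^∞⟮𝓡 n, M; 𝓘(ℝ, ℝ), ℝ⟯) (u : Sec n F V) :
    supp (mulSec n F V f u).1 ⊆ tsupport f :=
  closure_mono fun x hx h => hx (by rw [mulSec_apply, h]; simp)

theorem supp_mulSec_subset_right (f : C^∞⟮𝓡 n, M; 𝓘(ℝ, ℝ), ℝ⟯) (u : Sec n F V) :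
    supp (mulSec n F V f u).1 ⊆ supp u.1 :=
  closure_mono fun x hx h => hx (by rw [mulSec_apply, h]; simp)

theorem mulSec_mem_cSec {f : C^∞⟮𝓡 n, M; 𝓘(ℝ, ℝ), ℝ⟯} (hf : IsCompact (tsupport f))
    (u : Sec n F V) : mulSec n F V f u ∈ CSec n F V :=
  hf.of_isClosed_subset isClosed_closure (supp_mulSec_subset_left f u)

/-- Choose `f` with `f x = 1` and support disjoint from that of `u`. Then `fu = 0`, so `[A, f]u`
takes the value `-(Au)(x)` at `x`; the commutator has lower order, or is zero, and induction
applies. -/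
theorem IsDiffOpOfOrder.apply_eq_zero {m : ℕ} {A : Sec n F V →ₗ[ℂ] Sec n F' W}
    (hA : IsDiffOpOfOrder m A) {u : Sec n F V} {x : M} (hx : x ∉ supp u.1) : (A u).1 x = 0 := by
  obtain ⟨f, hf1, -, hfU, -⟩ := exists_cutoff (n := n) (isCompact_singleton (x := x))
    (isClosed_supp u.1).isOpen_compl (by simpa using hx)
  have hfx : f x = 1 := hf1.self_of_nhdsSet x rfl
  have hfu : mulSec n F V f u = 0 := by
    ext y
    rw [mulSec_apply]
    by_cases hy : y ∈ tsupport f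
    · rw [eq_zero_of_notMem_supp (hfU hy), smul_zero]; rfl
    · rw [image_eq_zero_of_notMem_tsupport hy]; simp
  have key : (commMul A f u).1 x = -(A u).1 x := by
    change (A (mulSec n F V f u)).1 x - (mulSec n F' W f (A u)).1 x = _
    rw [hfu, map_zero, mulSec_apply, hfx]
    change 0 - _ = _
    simp
  have hc : (commMul A f u).1 x = 0 := by
    cases m with
    | zero => rw [commMul, hA f]; rfl
    | succ m => exact IsDiffOpOfOrder.apply_eq_zero (hA f) hx
  rw [hc] at key
  exact neg_eq_zero.1 key.symm

theorem IsDiffOp.supp_subset {A : Sec n F V →ₗ[ℂ] Sec n F' W} (hA : IsDiffOp A) (u : Sec n F V) :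
    supp (A u).1 ⊆ supp u.1 := by
  obtain ⟨m, hm⟩ := hA
  exact closure_minimal (fun x hx => by_contra fun h => hx (hm.apply_eq_zero h)) isClosed_closure

theorem IsDiffOp.mem_cSec {A : Sec n F V →ₗ[ℂ] Sec n F' W} (hA : IsDiffOp A) {u : Sec n F V}
    (hu : u ∈ CSec n F V) : A u ∈ CSec n F' W :=
  IsCompact.of_isClosed_subset hu isClosed_closure (hA.supp_subset u)

theorem IsDiffOp.apply_congr {A : Sec n F V →ₗ[ℂ] Sec n F' W} (hA : IsDiffOp A)
    {u v : Sec n F V} {x : M} (h : ∀ᶠ y in 𝓝 x, u.1 y = v.1 y) : (A u).1 x = (A v).1 x := by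
  rw [← sub_eq_zero]
  change (A u - A v).1 x = 0
  rw [← map_sub]
  refine eq_zero_of_notMem_supp fun hx => notMem_supp_iff.2 ?_ (hA.supp_subset _ hx)
  filter_upwards [h] with y hy
  exact sub_eq_zero.2 hy

variable (n F V) in
/-- Every section agrees near a given point with a compactly supported one. -/
theorem exists_cSec_eventuallyEq (u : Sec n F V) (x : M) :
    ∃ v : CSec n F V, ∀ᶠ y in 𝓝 x, v.1.1 y = u.1 y := by
  obtain ⟨f, hf1, hfc, -, -⟩ := exists_cutoff (n := n) (isCompact_singleton (x := x))
    isOpen_univ (subset_univ _)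
  rw [nhdsSet_singleton] at hf1
  refine ⟨⟨_, mulSec_mem_cSec hfc u⟩, ?_⟩
  filter_upwards [hf1] with y hy
  rw [mulSec_apply, hy]; simp

/-- A differential operator is determined by its action on compactly supported sections. -/
theorem IsDiffOp.ext {A B : Sec n F V →ₗ[ℂ] Sec n F' W} (hA : IsDiffOp A) (hB : IsDiffOp B)
    (h : ∀ u : CSec n F V, A u = B u) : A = B := by
  ext u x
  obtain ⟨v, hv⟩ := exists_cSec_eventuallyEq n F V u x
  rw [← hA.apply_congr hv, ← hB.apply_congr hv, h]

end Locality

/-! ### Causal structure: chart vector fields, causal segments and compactness -/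

namespace Spacetime

variable {n : ℕ} {M : Type*} [TopologicalSpace M] [ChartedSpace (EuclideanSpace ℝ (Fin n)) M]
  [IsManifold (𝓡 n) ∞ M]

section Charts

/-- The vector field on the chart at `i` with constant components `v`. -/
noncomputable def chartVec (i : M) (y : EuclideanSpace ℝ (Fin n)) :
    EuclideanSpace ℝ (Fin n) →L[ℝ] TangentSpace (𝓡 n) ((extChartAt (𝓡 n) i).symm y) :=
  mfderiv 𝓘(ℝ, EuclideanSpace ℝ (Fin n)) (𝓡 n) (extChartAt (𝓡 n) i).symm y

/-- The derivative of the inverse chart is the inverse of the tangent bundle trivialization, so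
continuity of chart fields reduces to continuity of a trivialization. -/
theorem chartVec_eq_symm {i : M} {y : EuclideanSpace ℝ (Fin n)}
    (hy : y ∈ (extChartAt (𝓡 n) i).target) (v : EuclideanSpace ℝ (Fin n)) :
    chartVec i y v = (trivializationAt (EuclideanSpace ℝ (Fin n)) (TangentSpace (𝓡 n)) i).symm
      ((extChartAt (𝓡 n) i).symm y) v := by
  have hx : (extChartAt (𝓡 n) i).symm y ∈ (chartAt (EuclideanSpace ℝ (Fin n)) i).source := by
    rw [← extChartAt_source (𝓡 n)]
    exact (extChartAt (𝓡 n) i).map_target hy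
  have h := TangentBundle.symmL_trivializationAt (I := 𝓡 n) hx
  rw [(extChartAt (𝓡 n) i).right_inv hy] at h
  rw [← Trivialization.symmL_apply (R := ℝ) _ (by simpa using hx), h, chartVec]
  simp

theorem continuousOn_chartVec {α : Type*} [TopologicalSpace α] {s : Set α} (i : M)
    {y v : α → EuclideanSpace ℝ (Fin n)} (hy : ContinuousOn y s) (hv : ContinuousOn v s)
    (hs : MapsTo y s (extChartAt (𝓡 n) i).target) :
    ContinuousOn (fun a => TotalSpace.mk' (EuclideanSpace ℝ (Fin n))
      (E := fun x : M => TangentSpace (𝓡 n) x) ((extChartAt (𝓡 n) i).symm (y a))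
      (chartVec i (y a) (v a))) s := by
  have h1 : ContinuousOn (fun a => ((extChartAt (𝓡 n) i).symm (y a), v a)) s :=
    ((continuousOn_extChartAt_symm i).comp hy hs).prodMk hv
  refine ((trivializationAt (EuclideanSpace ℝ (Fin n))
    (TangentSpace (𝓡 n)) i).continuousOn_symm.comp h1 ?_).congr ?_
  · intro a ha
    refine ⟨?_, mem_univ _⟩
    have := (extChartAt (𝓡 n) i).map_target (hs ha)
    rw [extChartAt_source] at this
    simpa using this
  · intro a ha
    simp only [Function.comp_apply, chartVec_eq_symm (hs ha)]

/-- Stated for vector fields along a map `b`, so as to cover both families of base points and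
vectors varying together and the Gram matrix of the coordinate fields. -/
theorem continuousOn_metric (S : Spacetime n M) {α : Type*} [TopologicalSpace α] {s : Set α}
    {b : α → M} {v w : ∀ a, TangentSpace (𝓡 n) (b a)} (hb : ContinuousOn b s)
    (hv : ContinuousOn (fun a => TotalSpace.mk' (EuclideanSpace ℝ (Fin n))
      (E := fun x : M => TangentSpace (𝓡 n) x) (b a) (v a)) s)
    (hw : ContinuousOn (fun a => TotalSpace.mk' (EuclideanSpace ℝ (Fin n))
      (E := fun x : M => TangentSpace (𝓡 n) x) (b a) (w a)) s) :
    ContinuousOn (fun a => S.metric (b a) (v a) (w a)) s := by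
  have h : ContinuousOn (fun a => TotalSpace.mk' ℝ (E := Bundle.Trivial M ℝ) (b a)
      (S.metric (b a) (v a) (w a))) s := by
    apply ContinuousOn.clm_bundle_apply₂ (F₁ := EuclideanSpace ℝ (Fin n))
      (F₂ := EuclideanSpace ℝ (Fin n))
    · exact S.contMDiff.continuous.comp_continuousOn hb
    · exact hv
    · exact hw
  intro a ha
  exact ((FiberBundle.continuousWithinAt_totalSpace ℝ _).1 (h a ha)).2

theorem chartVec_bijective {i : M} {y : EuclideanSpace ℝ (Fin n)}
    (hy : y ∈ (extChartAt (𝓡 n) i).target) : Function.Bijective (chartVec i y) := by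
  have h := isInvertible_mfderivWithin_extChartAt_symm (I := 𝓡 n) hy
  have h2 : mfderivWithin 𝓘(ℝ, EuclideanSpace ℝ (Fin n)) (𝓡 n) (extChartAt (𝓡 n) i).symm
      (range (𝓡 n)) y = chartVec i y := by
    rw [chartVec, ModelWithCorners.Boundaryless.range_eq_univ, mfderivWithin_univ]
  rw [h2] at h
  exact h.bijective

/-- Every tangent vector is the value of a constant vector field of the chart. -/
theorem exists_chartVec_eq (p : M) (v : TangentSpace (𝓡 n) p) :
    ∃ w : EuclideanSpace ℝ (Fin n), TotalSpace.mk' (EuclideanSpace ℝ (Fin n))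
      (E := fun x : M => TangentSpace (𝓡 n) x) ((extChartAt (𝓡 n) p).symm (extChartAt (𝓡 n) p p))
      (chartVec p (extChartAt (𝓡 n) p p) w) = TotalSpace.mk' _ p v := by
  have hy := mem_extChartAt_target (I := 𝓡 n) p
  have hp : (extChartAt (𝓡 n) p).symm (extChartAt (𝓡 n) p p) = p := extChartAt_to_inv p
  -- The fibre over `φ⁻¹(φ p)` agrees with that over `p` only after rewriting, so `v` is transported
  -- by an equality in the total space.
  obtain ⟨v', hv'⟩ : ∃ v' : TangentSpace (𝓡 n) ((extChartAt (𝓡 n) p).symm (extChartAt (𝓡 n) p p)),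
      TotalSpace.mk' (EuclideanSpace ℝ (Fin n)) (E := fun x : M => TangentSpace (𝓡 n) x) _ v' =
        TotalSpace.mk' _ p v := by
    rw [hp]; exact ⟨v, rfl⟩
  obtain ⟨w, hw⟩ := (chartVec_bijective hy).2 v'
  exact ⟨w, by rw [hw, hv']⟩

end Charts

section Curves

variable (S : Spacetime n M)

/-- In a chart, the straight segments whose direction is close to that of the time orientation are
causal. -/
theorem exists_forall_isFutureCausal (p : M) :
    ∃ w : EuclideanSpace ℝ (Fin n), ∃ r > 0, Metric.ball (extChartAt (𝓡 n) p p) r ⊆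
      (extChartAt (𝓡 n) p).target ∧ ∀ y ∈ Metric.ball (extChartAt (𝓡 n) p p) r,
        ∀ v ∈ Metric.ball w r,
        S.IsFutureCausal ((extChartAt (𝓡 n) p).symm y) (chartVec p y v) := by
  set φ := extChartAt (𝓡 n) p
  obtain ⟨w, hw⟩ := exists_chartVec_eq p (S.timeField p)
  have hopen : IsOpen φ.target := isOpen_extChartAt_target p
  have h1 : ContinuousOn (fun a : EuclideanSpace ℝ (Fin n) × EuclideanSpace ℝ (Fin n) => a.1)
    (φ.target ×ˢ univ) := continuousOn_fst
  have hm : MapsTo (fun a : EuclideanSpace ℝ (Fin n) × EuclideanSpace ℝ (Fin n) => a.1)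
    (φ.target ×ˢ univ) φ.target := fun a ha => ha.1
  have hv := continuousOn_chartVec p h1 continuousOn_snd hm
  have hb := (continuousOn_extChartAt_symm (I := 𝓡 n) p).comp h1 hm
  have hc1 := S.continuousOn_metric hb hv hv
  have hc2 := S.continuousOn_metric hb (S.continuous_timeField.comp_continuousOn hb) hv
  have hmem : (φ p, w) ∈ φ.target ×ˢ (univ : Set (EuclideanSpace ℝ (Fin n))) :=
    ⟨mem_extChartAt_target p, mem_univ _⟩
  have hnhds : φ.target ×ˢ (univ : Set (EuclideanSpace ℝ (Fin n))) ∈ 𝓝 (φ p, w) :=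
    (hopen.prod isOpen_univ).mem_nhds hmem
  have e1 : S.metric (φ.symm (φ p)) (chartVec p (φ p) w) (chartVec p (φ p) w) < 0 := by
    have := congrArg (fun z : TotalSpace (EuclideanSpace ℝ (Fin n))
      (fun x : M => TangentSpace (𝓡 n) x) => S.metric z.1 z.2 z.2) hw
    exact this.trans_lt (S.timelike p)
  have e2 : S.metric (φ.symm (φ p)) (S.timeField (φ.symm (φ p))) (chartVec p (φ p) w) < 0 := by
    have := congrArg (fun z : TotalSpace (EuclideanSpace ℝ (Fin n))
      (fun x : M => TangentSpace (𝓡 n) x) => S.metric z.1 (S.timeField z.1) z.2) hw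
    exact this.trans_lt (S.timelike p)
  -- Both defining inequalities are strict at `(φ p, w)`, hence persist for nearby base points and
  -- directions.
  have ev1 := (hc1.continuousAt hnhds).eventually (gt_mem_nhds e1)
  have ev2 := (hc2.continuousAt hnhds).eventually (gt_mem_nhds e2)
  obtain ⟨r, hr, hball⟩ := Metric.eventually_nhds_iff_ball.1 ((ev1.and ev2).and hnhds)
  refine ⟨w, r, hr, fun y hy => ?_, fun y hy v hv => ?_⟩
  · have : (y, w) ∈ Metric.ball (φ p, w) r := by
      rw [← ball_prod_same]; exact ⟨hy, Metric.mem_ball_self hr⟩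
    exact (hball _ this).2.1
  · have : (y, v) ∈ Metric.ball (φ p, w) r := by
      rw [← ball_prod_same]; exact ⟨hy, hv⟩
    obtain ⟨⟨a1, a2⟩, -⟩ := hball _ this
    refine ⟨fun h0 => ?_, a1.le, a2⟩
    simp only [h0, map_zero, lt_self_iff_false] at a1

/-- A straight segment in a chart with future-directed causal velocity is a causal curve. -/
theorem causalCurve_of_segment (i : M) {y v : EuclideanSpace ℝ (Fin n)}
    (h : ∀ t ∈ Icc (0 : ℝ) 1, y + t • v ∈ (extChartAt (𝓡 n) i).target ∧
      S.IsFutureCausal ((extChartAt (𝓡 n) i).symm (y + t • v)) (chartVec i (y + t • v) v)) :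
    S.CausalCurve ((extChartAt (𝓡 n) i).symm y) ((extChartAt (𝓡 n) i).symm (y + v)) := by
  set φ := extChartAt (𝓡 n) i
  have hline : ContDiff ℝ ∞ (fun t : ℝ => y + t • v) := by fun_prop
  refine ⟨fun t => φ.symm (y + t • v), by simp, by simp, ?_, fun t ht => ?_⟩
  · exact ((contMDiffOn_extChartAt_symm (n := ∞) i).comp hline.contMDiff.contMDiffOn
      (fun t ht => (h t ht).1)).of_le (by simp)
  · have hd : HasMFDerivAt 𝓘(ℝ, EuclideanSpace ℝ (Fin n)) (𝓡 n) φ.symm (y + t • v)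
        (chartVec i (y + t • v)) := by
      refine MDifferentiableAt.hasMFDerivAt ?_
      have := mdifferentiableWithinAt_extChartAt_symm (I := 𝓡 n) (h t ht).1
      rwa [ModelWithCorners.Boundaryless.range_eq_univ, mdifferentiableWithinAt_univ] at this
    have hl : HasFDerivAt (fun t : ℝ => y + t • v)
        ((ContinuousLinearMap.id ℝ ℝ).smulRight v) t :=
      ((ContinuousLinearMap.id ℝ ℝ).hasFDerivAt.smul_const v).const_add y
    have hcomp := (hd.comp t hl.hasMFDerivAt).hasMFDerivWithinAt (s := Icc (0 : ℝ) 1)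
    have hu : UniqueMDiffWithinAt 𝓘(ℝ, ℝ) (Icc (0 : ℝ) 1) t :=
      (uniqueDiffOn_Icc zero_lt_one t ht).uniqueMDiffWithinAt
    have := HasMFDerivWithinAt.mfderivWithin hcomp hu
    have key : mfderivWithin 𝓘(ℝ, ℝ) (𝓡 n) (fun t => φ.symm (y + t • v)) (Icc 0 1) t (1 : ℝ) =
        chartVec i (y + t • v) v := by
      change mfderivWithin 𝓘(ℝ, ℝ) (𝓡 n) (φ.symm ∘ fun t => (y + t • v)) (Icc 0 1) t (1 : ℝ) = _
      rw [this]
      change chartVec i (y + t • v) ((1 : ℝ) • v) = _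
      rw [one_smul]
    rw [key]
    exact (h t ht).2

theorem IsFutureCausal.smul {S : Spacetime n M} {x : M} {v : TangentSpace (𝓡 n) x}
    (h : S.IsFutureCausal x v) {c : ℝ} (hc : 0 < c) : S.IsFutureCausal x (c • v) := by
  obtain ⟨h1, h2, h3⟩ := h
  refine ⟨smul_ne_zero hc.ne' h1, ?_, ?_⟩
  · simp only [map_smul, smul_apply, smul_eq_mul]
    exact mul_nonpos_of_nonneg_of_nonpos hc.le (mul_nonpos_of_nonneg_of_nonpos hc.le h2)
  · simp only [map_smul, smul_eq_mul]
    exact mul_neg_of_pos_of_neg hc h3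

/-- Every point lies in the interior of the future of some point and of the past of another. -/
theorem exists_mem_nhds_J (τ : TimeDir) (p : M) : ∃ q, S.J τ {q} ∈ 𝓝 p := by
  obtain ⟨w, r, hr, htar, hw⟩ := S.exists_forall_isFutureCausal p
  set φ := extChartAt (𝓡 n) p
  -- Small enough that the displacement of `φ p` by `± ε w` stays within the ball on which segments
  -- are controlled.
  obtain ⟨ε, hε, hεw⟩ : ∃ ε > 0, ε * ‖w‖ < r / 2 := by
    refine ⟨r / 2 / (‖w‖ + 1), by positivity, ?_⟩
    rw [div_mul_eq_mul_div, div_lt_iff₀ (by positivity)]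
    nlinarith [norm_nonneg w]
  have hN : φ ⁻¹' Metric.ball (φ p) (min (r / 2) (ε * r)) ∈ 𝓝 p :=
    (continuousAt_extChartAt p).preimage_mem_nhds (Metric.ball_mem_nhds _ (by positivity))
  have hsrc : φ.source ∈ 𝓝 p := extChartAt_source_mem_nhds p
  -- If `v` is within `ε r` of `ε w`, then `ε⁻¹ v` is within `r` of `w`, hence a causal direction,
  -- and causality is invariant under positive scaling. The ball is convex, so the whole segment
  -- stays in it.
  have seg : ∀ y v : EuclideanSpace ℝ (Fin n), y ∈ Metric.ball (φ p) r →
      y + v ∈ Metric.ball (φ p) r → ‖v - ε • w‖ < ε * r →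
      S.CausalCurve (φ.symm y) (φ.symm (y + v)) := by
    intro y v hy hyv hv
    refine S.causalCurve_of_segment p fun t ht => ?_
    have hmem : y + t • v ∈ Metric.ball (φ p) r := by
      have := (convex_ball (φ p) r).add_smul_mem hy hyv ht
      exact this
    refine ⟨htar hmem, ?_⟩
    have h1 := hw _ hmem (ε⁻¹ • v) (by
      rw [mem_ball_iff_norm]
      have : ε⁻¹ • v - w = ε⁻¹ • (v - ε • w) := by
        rw [smul_sub, smul_smul, inv_mul_cancel₀ hε.ne', one_smul]
      rw [this, norm_smul, Real.norm_of_nonneg (by positivity), inv_mul_lt_iff₀ hε]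
      exact hv)
    have h2 := h1.smul hε
    rwa [map_smul, smul_smul, mul_inv_cancel₀ hε.ne', one_smul] at h2
  have hnw : ‖ε • w‖ < r / 2 := by rwa [norm_smul, Real.norm_of_nonneg hε.le]
  cases τ with
  | future =>
    refine ⟨φ.symm (φ p - ε • w), ?_⟩
    filter_upwards [hN, hsrc] with x hx hxs
    refine ⟨_, rfl, Relation.ReflTransGen.single ?_⟩
    have hx' : ‖φ x - φ p‖ < min (r / 2) (ε * r) := mem_ball_iff_norm.1 hx
    have hx1 := hx'.trans_le (min_le_left _ _)
    have hx2 := hx'.trans_le (min_le_right _ _)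
    have := seg (φ p - ε • w) (φ x - φ p + ε • w)
      (by rw [mem_ball_iff_norm]; simpa using hnw.trans (by linarith))
      (by rw [mem_ball_iff_norm]
          have : φ p - ε • w + (φ x - φ p + ε • w) - φ p = φ x - φ p := by abel
          rw [this]; linarith)
      (by simpa using hx2)
    have e : φ p - ε • w + (φ x - φ p + ε • w) = φ x := by abel
    rwa [e, φ.left_inv hxs] at this
  | past =>
    refine ⟨φ.symm (φ p + ε • w), ?_⟩
    filter_upwards [hN, hsrc] with x hx hxs
    refine ⟨_, rfl, Relation.ReflTransGen.single ?_⟩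
    have hx' : ‖φ x - φ p‖ < min (r / 2) (ε * r) := mem_ball_iff_norm.1 hx
    have hx1 := hx'.trans_le (min_le_left _ _)
    have hx2 := hx'.trans_le (min_le_right _ _)
    have := seg (φ x) (φ p + ε • w - φ x)
      (by rw [mem_ball_iff_norm]; linarith)
      (by rw [mem_ball_iff_norm]
          have : φ x + (φ p + ε • w - φ x) - φ p = ε • w := by abel
          rw [this]; linarith)
      (by have : φ p + ε • w - φ x - ε • w = -(φ x - φ p) := by abel
          rw [this, norm_neg]; exact hx2)
    have e : φ x + (φ p + ε • w - φ x) = φ p + ε • w := by abel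
    rwa [e, φ.left_inv hxs] at this

theorem subset_J (τ : TimeDir) (A : Set M) : A ⊆ S.J τ A := by
  cases τ <;> exact fun q hq => ⟨q, hq, Relation.ReflTransGen.refl⟩

theorem J_J_subset (τ : TimeDir) (A : Set M) : S.J τ (S.J τ A) ⊆ S.J τ A := by
  cases τ
  · rintro q ⟨p, ⟨o, ho, hop⟩, hpq⟩; exact ⟨o, ho, hop.trans hpq⟩
  · rintro q ⟨p, ⟨o, ho, hop⟩, hpq⟩; exact ⟨o, ho, hpq.trans hop⟩

theorem J_subset_of_subset {τ : TimeDir} {A B : Set M} (h : A ⊆ S.J τ B) : S.J τ A ⊆ S.J τ B :=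
  (S.J_mono τ h).trans (S.J_J_subset τ B)

theorem J_empty (τ : TimeDir) : S.J τ ∅ = ∅ := by
  cases τ <;> simp [J]

theorem J_union (τ : TimeDir) (A B : Set M) : S.J τ (A ∪ B) = S.J τ A ∪ S.J τ B := by
  cases τ <;> ext q <;> simp [J, or_and_right, exists_or]

theorem mem_J_iff_exists (τ : TimeDir) {A : Set M} {q : M} :
    q ∈ S.J τ A ↔ ∃ p ∈ A, q ∈ S.J τ {p} := by
  cases τ <;> simp [J]

/-- The opposite time direction. -/
def _root_.GreenHyp.TimeDir.rev : TimeDir → TimeDir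
  | .future => .past
  | .past => .future

theorem mem_J_singleton_comm (τ : TimeDir) {p q : M} : q ∈ S.J τ {p} ↔ p ∈ S.J τ.rev {q} := by
  cases τ <;> simp [J, TimeDir.rev]

theorem GloballyHyperbolic.isCompact_inter {S : Spacetime n M} (hS : S.GloballyHyperbolic)
    (τ : TimeDir) (p q : M) : IsCompact (S.J τ {p} ∩ S.J τ.rev {q}) := by
  cases τ with
  | future => exact hS.2 p q
  | past => rw [inter_comm]; exact hS.2 q p

/-- For compact `C`, the intersections of `J^±(C)` with the `J^∓(y)`, `y` near a given point, lie in
a common compact set. -/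
theorem GloballyHyperbolic.exists_isCompact_superset {S : Spacetime n M}
    (hS : S.GloballyHyperbolic) (τ : TimeDir) {C : Set M} (hC : IsCompact C) (x : M) :
    ∃ Z, IsCompact Z ∧ ∀ᶠ y in 𝓝 x, S.J τ C ∩ S.J τ.rev {y} ⊆ Z := by
  -- All `y` near `x` lie on the appropriate side of one point `q`, and `C` is covered by finitely
  -- many sets `J τ {g p}`. Transitivity then leaves finitely many compact diamonds; `J τ C` itself
  -- need not be known to be closed.
  obtain ⟨q, hq⟩ := S.exists_mem_nhds_J τ.rev x
  choose g hg using S.exists_mem_nhds_J τ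
  obtain ⟨t, -, ht⟩ := hC.elim_nhds_subcover (fun p => S.J τ {g p}) fun p _ => hg p
  refine ⟨⋃ p ∈ t, S.J τ {g p} ∩ S.J τ.rev {q}, t.isCompact_biUnion fun p _ =>
    hS.isCompact_inter τ _ _, ?_⟩
  filter_upwards [hq] with y hy
  rintro z ⟨hz, hzy⟩
  obtain ⟨c, hc, hzc⟩ := (S.mem_J_iff_exists τ).1 hz
  obtain ⟨p, hp, hcp⟩ := mem_iUnion₂.1 (ht hc)
  refine mem_iUnion₂.2 ⟨p, hp, ?_, ?_⟩
  · exact S.J_subset_of_subset (singleton_subset_iff.2 hcp) hzc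
  · exact S.J_subset_of_subset (singleton_subset_iff.2 hy) hzy

end Curves

end Spacetime

/-! ### Extension of propagators to supports in `J^±(C)`, and uniqueness -/

section Extension

variable {n : ℕ} {M : Type*} [TopologicalSpace M] [ChartedSpace (EuclideanSpace ℝ (Fin n)) M]
  [IsManifold (𝓡 n) ∞ M] [T2Space M] [SigmaCompactSpace M]
  {F : Type*} [NormedAddCommGroup F] [NormedSpace ℂ F]
  {V : M → Type*} [TopologicalSpace (TotalSpace F V)] [∀ x, AddCommGroup (V x)]
  [∀ x, Module ℂ (V x)] [∀ x, TopologicalSpace (V x)] [FiberBundle F V] [VectorBundle ℂ F V]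
  {S : Spacetime n M} {τ : TimeDir} {D : Sec n F V →ₗ[ℂ] Sec n F V}
  {G : CSec n F V →ₗ[ℂ] Sec n F V}

/-- Cut `w` off by a function equal to one near a compact set containing every point of `J τ C` that
can influence a neighbourhood of `x`. What is cut away does not influence that neighbourhood. -/
theorem CausalSec.exists_approx (hS : S.GloballyHyperbolic) (w : CausalSec F V S τ) (x : M) :
    ∃ u : CSec n F V, supp u.1.1 ⊆ supp w.1.1 ∧
      ∀ᶠ y in 𝓝 x, y ∉ S.J τ (supp (w.1 - u.1).1) := by
  obtain ⟨C, hC, hwC⟩ := w.2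
  obtain ⟨Z, hZ, hx⟩ := hS.exists_isCompact_superset τ hC x
  obtain ⟨f, hf1, hfc, -, -⟩ := exists_cutoff (n := n) hZ isOpen_univ (subset_univ _)
  refine ⟨⟨mulSec n F V f w.1, mulSec_mem_cSec hfc _⟩, supp_mulSec_subset_right f w.1, ?_⟩
  filter_upwards [hx] with y hy hyJ
  obtain ⟨p, hp, hyp⟩ := (S.mem_J_iff_exists τ).1 hyJ
  have hpw : p ∈ supp w.1.1 :=
    (supp_sub_subset _ _ hp).elim id fun h => supp_mulSec_subset_right f w.1 h
  have hpZ : p ∈ Z := hy ⟨hwC hpw, (S.mem_J_singleton_comm τ).1 hyp⟩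
  refine notMem_supp_iff.2 ?_ hp
  filter_upwards [eventually_nhdsSet_iff_forall.1 hf1 p hpZ] with z hz
  change w.1.1 z - ((f z : ℝ) : ℂ) • w.1.1 z = 0
  simp [hz]

/-- Finite propagation: by linearity and the support property, `G (u - v)` vanishes at points not
reached from the support of `u - v`. -/
theorem IsPropagator.apply_congr (hG : IsPropagator S τ D G) {u v : CSec n F V} {x : M}
    (hx : x ∉ S.J τ (supp (u.1 - v.1).1)) : (G u).1 x = (G v).1 x := by
  rw [← sub_eq_zero]
  change (G u - G v).1 x = 0
  rw [← map_sub]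
  exact eq_zero_of_notMem_supp fun h => hx (hG.supp_subset _ h)

/-- The pointwise value of the extended propagator. -/
noncomputable def extendValue (hS : S.GloballyHyperbolic) (G : CSec n F V →ₗ[ℂ] Sec n F V)
    (w : CausalSec F V S τ) (x : M) : V x :=
  (G (CausalSec.exists_approx hS w x).choose).1 x

/-- Independence of the approximant: two of them differ by `(w - u) - (w - u₀)`, and neither term
influences `x`. -/
theorem IsPropagator.extendValue_eq (hG : IsPropagator S τ D G) (hS : S.GloballyHyperbolic)
    {w : CausalSec F V S τ} {u : CSec n F V} {x : M} (hx : x ∉ S.J τ (supp (w.1 - u.1).1)) :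
    extendValue hS G w x = (G u).1 x := by
  refine hG.apply_congr fun h => ?_
  have h0 := (CausalSec.exists_approx hS w x).choose_spec.2.self_of_nhds
  set u₀ := (CausalSec.exists_approx hS w x).choose
  have e : u₀.1 - u.1 = (w.1 - u.1) - (w.1 - u₀.1) := by abel
  rw [e] at h
  have := S.J_mono τ (supp_sub_subset _ _) h
  rw [S.J_union] at this
  exact this.elim hx h0

/-- A single approximant serves a whole neighbourhood of `x`. This gives smoothness of the extension
and allows a differential operator to be applied to it. -/
theorem IsPropagator.eventually_extendValue_eq (hG : IsPropagator S τ D G)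
    (hS : S.GloballyHyperbolic) (w : CausalSec F V S τ) (x : M) :
    ∃ u : CSec n F V, supp u.1.1 ⊆ supp w.1.1 ∧
      x ∉ S.J τ (supp (w.1 - u.1).1) ∧ ∀ᶠ y in 𝓝 x, extendValue hS G w y = (G u).1 y := by
  obtain ⟨u, hu, hx⟩ := CausalSec.exists_approx hS w x
  exact ⟨u, hu, hx.self_of_nhds, hx.mono fun y hy => hG.extendValue_eq hS hy⟩

theorem IsPropagator.supp_extendValue_subset (hG : IsPropagator S τ D G)
    (hS : S.GloballyHyperbolic) (w : CausalSec F V S τ) :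
    supp (extendValue hS G w) ⊆ S.J τ (supp w.1.1) := by
  intro x hx
  obtain ⟨u, hu, -, hev⟩ := hG.eventually_extendValue_eq hS w x
  refine S.J_mono τ hu (hG.supp_subset u ?_)
  by_contra h
  refine notMem_supp_iff.2 ?_ hx
  filter_upwards [hev, notMem_supp_iff.1 h] with y h1 h2
  rw [h1, h2]

/-- The extension of a propagator to sections supported in `J^±(C)`, `C` compact. -/
noncomputable def IsPropagator.extend (hG : IsPropagator S τ D G) (hS : S.GloballyHyperbolic) :
    CausalSec F V S τ →ₗ[ℂ] CausalSec F V S τ where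
  toFun w := ⟨⟨extendValue hS G w, fun x => by
      obtain ⟨u, -, -, hev⟩ := hG.eventually_extendValue_eq hS w x
      refine ((G u).2 x).congr_of_eventuallyEq ?_
      filter_upwards [hev] with y hy
      rw [hy]⟩, by
    obtain ⟨C, hC, hwC⟩ := w.2
    exact ⟨C, hC, (hG.supp_extendValue_subset hS w).trans (S.J_subset_of_subset hwC)⟩⟩
  map_add' w w' := by
    ext x
    obtain ⟨u, -, hx, -⟩ := hG.eventually_extendValue_eq hS w x
    obtain ⟨u', -, hx', -⟩ := hG.eventually_extendValue_eq hS w' x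
    have h : x ∉ S.J τ (supp ((w + w').1 - (u + u').1).1) := by
      intro h
      have e : (w + w').1 - (u + u').1 = (w.1 - u.1) + (w'.1 - u'.1) := by
        rw [Submodule.coe_add, Submodule.coe_add]; abel
      rw [e] at h
      have := S.J_mono τ (supp_add_subset _ _) h
      rw [S.J_union] at this
      exact this.elim hx hx'
    change extendValue hS G (w + w') x = extendValue hS G w x + extendValue hS G w' x
    rw [hG.extendValue_eq hS h, hG.extendValue_eq hS hx, hG.extendValue_eq hS hx', map_add]
    rfl
  map_smul' c w := by
    ext x
    obtain ⟨u, -, hx, -⟩ := hG.eventually_extendValue_eq hS w x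
    have h : x ∉ S.J τ (supp ((c • w).1 - (c • u).1).1) := by
      intro h
      have e : (c • w).1 - (c • u).1 = c • (w.1 - u.1) := by
        rw [Submodule.coe_smul, Submodule.coe_smul]; module
      rw [e] at h
      exact hx (S.J_mono τ (supp_smul_subset _ _) h)
    change extendValue hS G (c • w) x = c • extendValue hS G w x
    rw [hG.extendValue_eq hS h, hG.extendValue_eq hS hx, map_smul]
    rfl

theorem IsPropagator.isExtendedPropagator (hG : IsPropagator S τ D G) (hD : IsDiffOp D)
    (hS : S.GloballyHyperbolic) : IsExtendedPropagator S τ D G (hG.extend hS) where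
  extends_propagator u w hw := by
    ext x
    change extendValue hS G w x = _
    refine hG.extendValue_eq hS ?_
    rw [hw]
    have : supp (u.1 - u.1).1 = (∅ : Set M) := by
      have e : (u.1 - u.1) = 0 := by abel
      rw [e]
      exact supp_zero M V
    rw [this, S.J_empty]
    exact notMem_empty x
  right_inv w := by
    ext x
    obtain ⟨u, -, hx, hev⟩ := hG.eventually_extendValue_eq hS w x
    -- By locality `D` sees only `G u` near `x`, so the value is `u x`; this equals `w x` because
    -- `x` lies outside the support of `w - u`.
    have h1 : (D (hG.extend hS w).1).1 x = (D (G u)).1 x := hD.apply_congr hev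
    rw [h1, hG.right_inv]
    have := eq_zero_of_notMem_supp fun h => hx (S.subset_J τ _ h)
    exact (sub_eq_zero.1 this).symm
  left_inv w hw := by
    ext x
    obtain ⟨u, -, hx⟩ := CausalSec.exists_approx hS w x
    have hx := hx.self_of_nhds
    have hDu : D u.1 ∈ CSec n F V := hD.mem_cSec u.2
    -- Since `D` does not enlarge supports, `D u` is an admissible approximant of `D w` at `x`.
    have h : x ∉ S.J τ (supp (D w.1 - D u.1).1) := by
      rw [← map_sub]
      exact fun h => hx (S.J_mono τ (hD.supp_subset _) h)
    have h1 : extendValue hS G ⟨D w.1, hw⟩ x = (G ⟨D u.1, hDu⟩).1 x := hG.extendValue_eq hS h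
    change extendValue hS G ⟨D w.1, hw⟩ x = w.1.1 x
    rw [h1, hG.left_inv]
    have := eq_zero_of_notMem_supp fun h => hx (S.subset_J τ _ h)
    exact (sub_eq_zero.1 this).symm
  supp_subset w := hG.supp_extendValue_subset hS w

/-- Sections with support in `J^±(C)`, `C` compact, are determined by their image under a
differential operator with a propagator. -/
theorem IsPropagator.injOn_causalSec (hG : IsPropagator S τ D G) (hD : IsDiffOp D)
    (hS : S.GloballyHyperbolic) {v w : Sec n F V} (hv : v ∈ CausalSec F V S τ)
    (hw : w ∈ CausalSec F V S τ) (h : D v = D w) : v = w := by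
  have hx := hG.isExtendedPropagator hD hS
  have hmem : ∀ z ∈ CausalSec F V S τ, D z ∈ CausalSec F V S τ := by
    rintro z ⟨C, hC, hz⟩
    exact ⟨C, hC, (hD.supp_subset z).trans hz⟩
  have h1 := hx.left_inv ⟨v, hv⟩ (hmem v hv)
  have h2 := hx.left_inv ⟨w, hw⟩ (hmem w hw)
  simp only [h] at h1
  exact congrArg Subtype.val (h1.symm.trans h2)

/-- Both extensions are right inverses of `D` with values in a space on which `D` is injective. -/
theorem IsExtendedPropagator.eq (hD : IsDiffOp D) (hG : IsPropagator S τ D G)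
    (hS : S.GloballyHyperbolic) {G₁ G₂ : CausalSec F V S τ →ₗ[ℂ] CausalSec F V S τ}
    (h₁ : IsExtendedPropagator S τ D G G₁) (h₂ : IsExtendedPropagator S τ D G G₂) : G₁ = G₂ := by
  refine LinearMap.ext fun w => Subtype.ext ?_
  exact hG.injOn_causalSec hD hS (G₁ w).2 (G₂ w).2 ((h₁.right_inv w).trans (h₂.right_inv w).symm)

theorem IsPropagator.existsUnique_extension (hG : IsPropagator S τ D G) (hD : IsDiffOp D)
    (hS : S.GloballyHyperbolic) : ∃! Gx, IsExtendedPropagator S τ D G Gx :=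
  ⟨hG.extend hS, hG.isExtendedPropagator hD hS, fun _ h =>
    IsExtendedPropagator.eq hD hG hS h (hG.isExtendedPropagator hD hS)⟩

theorem CSec.mem_causalSec (S : Spacetime n M) (τ : TimeDir) {u : Sec n F V}
    (hu : u ∈ CSec n F V) : u ∈ CausalSec F V S τ := ⟨supp u.1, hu, S.subset_J τ _⟩

theorem CausalSec.mem_of_supp_subset {F' : Type*} [NormedAddCommGroup F'] [NormedSpace ℂ F']
    {W : M → Type*} [TopologicalSpace (TotalSpace F' W)] [∀ x, AddCommGroup (W x)]
    [∀ x, Module ℂ (W x)] [∀ x, TopologicalSpace (W x)] [FiberBundle F' W] [VectorBundle ℂ F' W]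
    {u : Sec n F V} {v : Sec n F' W} (hu : u ∈ CausalSec F V S τ)
    (h : supp v.1 ⊆ S.J τ (supp u.1)) : v ∈ CausalSec F' W S τ := by
  obtain ⟨C, hC, hu⟩ := hu
  exact ⟨C, hC, h.trans (S.J_subset_of_subset hu)⟩

theorem IsPropagator.mem_causalSec (hG : IsPropagator S τ D G) (u : CSec n F V) :
    G u ∈ CausalSec F V S τ :=
  CausalSec.mem_of_supp_subset (CSec.mem_causalSec S τ u.2) (hG.supp_subset u)

/-- Propagators are unique. -/
theorem IsPropagator.eq (hD : IsDiffOp D) (hS : S.GloballyHyperbolic)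
    {G' : CSec n F V →ₗ[ℂ] Sec n F V}
    (hG : IsPropagator S τ D G) (hG' : IsPropagator S τ D G') : G = G' :=
  LinearMap.ext fun u => hG.injOn_causalSec hD hS (hG.mem_causalSec u) (hG'.mem_causalSec u)
    ((hG.right_inv u).trans (hG'.right_inv u).symm)

end Extension

/-! ### The volume density and positivity of the integral -/

namespace Spacetime

section Density

variable {n : ℕ} {M : Type*} [TopologicalSpace M] [ChartedSpace (EuclideanSpace ℝ (Fin n)) M]
  [IsManifold (𝓡 n) ∞ M] (S : Spacetime n M)

theorem continuousOn_density (i : M) : ContinuousOn (S.density i) (extChartAt (𝓡 n) i).target := by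
  have hv : ∀ k : Fin n, ContinuousOn (fun y => TotalSpace.mk' (EuclideanSpace ℝ (Fin n))
      (E := fun x : M => TangentSpace (𝓡 n) x) ((extChartAt (𝓡 n) i).symm y) (coordVec i y k))
      (extChartAt (𝓡 n) i).target := fun k =>
    continuousOn_chartVec (v := fun _ => EuclideanSpace.single k (1 : ℝ)) i continuousOn_id
      continuousOn_const (mapsTo_id _)
  have hm : ContinuousOn (fun y => Matrix.of fun j k : Fin n =>
      S.metric ((extChartAt (𝓡 n) i).symm y) (coordVec i y j) (coordVec i y k))
      (extChartAt (𝓡 n) i).target :=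
    continuousOn_pi.2 fun j => continuousOn_pi.2 fun k =>
      S.continuousOn_metric (continuousOn_extChartAt_symm i) (hv j) (hv k)
  have hdet : Continuous fun A : Matrix (Fin n) (Fin n) ℝ => √|A.det| :=
    Real.continuous_sqrt.comp (continuous_abs.comp (continuous_id.matrix_det))
  exact hdet.comp_continuousOn hm

/-- A vector orthogonal to everything is orthogonal to the timelike `t`, and on the complement of
`t` the metric is positive definite. -/
theorem metric_nondegenerate (x : M) (u : TangentSpace (𝓡 n) x)
    (h : ∀ v, S.metric x v u = 0) : u = 0 := by
  obtain ⟨t, -, ht⟩ := S.signature x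
  by_contra hu
  exact (ht u (h t) hu).ne' (h u)

/-- A kernel vector `c` of the Gram matrix yields a tangent vector `∑ c_k ∂_k` orthogonal to the
coordinate basis, hence zero by nondegeneracy of the metric. -/
theorem density_pos {i : M} {y : EuclideanSpace ℝ (Fin n)}
    (hy : y ∈ (extChartAt (𝓡 n) i).target) : 0 < S.density i y := by
  refine Real.sqrt_pos.2 (abs_pos.2 fun hdet => ?_)
  obtain ⟨c, hc, hGc⟩ := Matrix.exists_mulVec_eq_zero_iff.2 hdet
  set x := (extChartAt (𝓡 n) i).symm y
  have hsum : ∀ d : Fin n → ℝ,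
      chartVec i y (WithLp.toLp 2 d) = ∑ k, d k • coordVec i y k := by
    intro d
    have : WithLp.toLp 2 d = ∑ k, d k • EuclideanSpace.single k (1 : ℝ) := by
      ext j
      simp [Finset.sum_apply, Pi.single_apply]
    rw [this, map_sum]
    simp only [map_smul]
    rfl
  have h0 : chartVec i y (WithLp.toLp 2 c) = 0 := by
    have hj : ∀ j, S.metric x (coordVec i y j) (chartVec i y (WithLp.toLp 2 c)) = 0 := by
      intro j
      have := congrFun hGc j
      simp only [Matrix.mulVec, dotProduct, Matrix.of_apply, Pi.zero_apply] at this
      rw [hsum, map_sum, ← this]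
      exact Finset.sum_congr rfl fun k _ => by rw [map_smul, smul_eq_mul, mul_comm]
    refine S.metric_nondegenerate x _ fun v => ?_
    obtain ⟨d, rfl⟩ := (chartVec_bijective hy).2 v
    have hd : d = WithLp.toLp 2 (fun k => d k) := rfl
    rw [hd, hsum, map_sum, sum_apply]
    exact Finset.sum_eq_zero fun j _ => by rw [map_smul, smul_apply, hj, smul_zero]
  have hz := (chartVec_bijective hy).1 (h0.trans (map_zero _).symm)
  exact hc (funext fun k => congrArg (fun v : EuclideanSpace ℝ (Fin n) => v k) hz)

end Density

section Integral

variable {n : ℕ} {M : Type*} [TopologicalSpace M] [ChartedSpace (EuclideanSpace ℝ (Fin n)) M]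
  [IsManifold (𝓡 n) ∞ M] [T2Space M] [SigmaCompactSpace M] (S : Spacetime n M)

theorem tsupport_chartPartition_subset (i : M) :
    tsupport (chartPartition n M i) ⊆ (extChartAt (𝓡 n) i).source := by
  rw [extChartAt_source]
  exact (SmoothPartitionOfUnity.exists_isSubordinate_chartAt_source
    (I := 𝓡 n) M).choose_spec i

/-- The integrand of `Spacetime.integral` in the chart at `i`. -/
noncomputable def chartIntegrand (f : M → ℂ) (i : M) (y : EuclideanSpace ℝ (Fin n)) : ℂ :=
  ((chartPartition n M i ((extChartAt (𝓡 n) i).symm y) * S.density i y : ℝ) : ℂ) *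
    f ((extChartAt (𝓡 n) i).symm y)

theorem integral_def (f : M → ℂ) : S.integral f =
    ∑ᶠ i : M, ∫ y in (extChartAt (𝓡 n) i).target, S.chartIntegrand f i y := rfl

theorem continuousOn_chartIntegrand {f : M → ℂ} (hf : Continuous f) (i : M) :
    ContinuousOn (S.chartIntegrand f i) (extChartAt (𝓡 n) i).target := by
  have hs := continuousOn_extChartAt_symm (I := 𝓡 n) i
  exact (Complex.continuous_ofReal.comp_continuousOn
    (((chartPartition n M i).contMDiff.continuous.comp_continuousOn hs).mul
      (S.continuousOn_density i))).mul (hf.comp_continuousOn hs)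

/-- The integrand is continuous on the chart target and vanishes there outside the compact image of
the intersection of the supports of `f` and of the partition function. -/
theorem integrableOn_chartIntegrand {f : M → ℂ} (hf : Continuous f) (hc : HasCompactSupport f)
    (i : M) : IntegrableOn (S.chartIntegrand f i) (extChartAt (𝓡 n) i).target := by
  set φ := extChartAt (𝓡 n) i
  set k : Set M := tsupport (chartPartition n M i) ∩ tsupport f
  have hks : k ⊆ φ.source := inter_subset_left.trans (tsupport_chartPartition_subset i)
  have hk : IsCompact k := hc.inter_left (isClosed_tsupport _)
  have hφk : IsCompact (φ '' k) := hk.image_of_continuousOn ((continuousOn_extChartAt i).mono hks)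
  have hsub : φ '' k ⊆ φ.target := by
    rintro _ ⟨x, hx, rfl⟩
    exact φ.map_source (hks hx)
  have hint : IntegrableOn (S.chartIntegrand f i) (φ '' k) :=
    ((S.continuousOn_chartIntegrand hf i).mono hsub).integrableOn_compact hφk
  refine hint.of_forall_sdiff_eq_zero (isOpen_extChartAt_target i).measurableSet ?_
  rintro y ⟨hy, hyk⟩
  have : φ.symm y ∉ k := fun h => hyk ⟨_, h, φ.right_inv hy⟩
  rw [chartIntegrand]
  by_cases h1 : φ.symm y ∈ tsupport (chartPartition n M i)
  · rw [image_eq_zero_of_notMem_tsupport fun h2 => this ⟨h1, h2⟩, mul_zero]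
  · rw [image_eq_zero_of_notMem_tsupport h1]; simp

/-- Local finiteness of the partition against a compact set. Without it `finsum` could take its
default value zero, and additivity of the integral could fail. -/
theorem hasFiniteSupport_chartIntegral {f : M → ℂ} (hc : HasCompactSupport f) :
    (Function.support fun i : M =>
      ∫ y in (extChartAt (𝓡 n) i).target, S.chartIntegrand f i y).Finite := by
  refine ((chartPartition n M).locallyFinite.finite_nonempty_inter_compact hc).subset ?_
  intro i hi
  by_contra h
  rw [mem_ofPred_eq, not_nonempty_iff_eq_empty] at h
  refine hi ?_
  have : ∀ y, S.chartIntegrand f i y = 0 := by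
    intro y
    rw [chartIntegrand]
    by_cases h1 : chartPartition n M i ((extChartAt (𝓡 n) i).symm y) = 0
    · rw [h1]; simp
    · rw [image_eq_zero_of_notMem_tsupport (f := f) fun h2 =>
        (h ▸ ⟨h1, h2⟩ : (extChartAt (𝓡 n) i).symm y ∈ (∅ : Set M)), mul_zero]
  simp [this]

theorem integral_add {f g : M → ℂ} (hf : Continuous f) (hfc : HasCompactSupport f)
    (hg : Continuous g) (hgc : HasCompactSupport g) :
    S.integral (fun x => f x + g x) = S.integral f + S.integral g := by
  rw [integral_def, integral_def, integral_def, ← finsum_add_distrib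
    (S.hasFiniteSupport_chartIntegral hfc) (S.hasFiniteSupport_chartIntegral hgc)]
  refine finsum_congr fun i => ?_
  rw [← MeasureTheory.integral_add (S.integrableOn_chartIntegrand hf hfc i)
    (S.integrableOn_chartIntegrand hg hgc i)]
  simp only [chartIntegrand, mul_add]

/-- Needs no integrability, and neither does `integral_conj`; so scalars and conjugation pass
through the pairing without support conditions, unlike sums. -/
theorem integral_const_mul (c : ℂ) (f : M → ℂ) :
    S.integral (fun x => c * f x) = c * S.integral f := by
  rw [integral_def, integral_def, mul_finsum]
  refine finsum_congr fun i => ?_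
  rw [← MeasureTheory.integral_const_mul]
  simp only [chartIntegrand, mul_left_comm]

theorem integral_conj (f : M → ℂ) :
    S.integral (fun x => (starRingEnd ℂ) (f x)) = (starRingEnd ℂ) (S.integral f) := by
  rw [integral_def, integral_def]
  have := (starRingAut (R := ℂ)).toAddEquiv.map_finsum
    (fun i => ∫ y in (extChartAt (𝓡 n) i).target, S.chartIntegrand f i y)
  refine Eq.trans (finsum_congr fun i => ?_) this.symm
  refine Eq.trans ?_ (_root_.integral_conj (𝕜 := ℂ))
  simp only [chartIntegrand, map_mul, Complex.conj_ofReal]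

theorem integral_re_pos {f : M → ℂ} (hf : Continuous f) (hc : HasCompactSupport f)
    (h0 : ∀ x, 0 ≤ (f x).re) {x : M} (hx : 0 < (f x).re) : 0 < (S.integral f).re := by
  have hre : (S.integral f).re = ∑ᶠ i : M, ∫ y in (extChartAt (𝓡 n) i).target,
      (S.chartIntegrand f i y).re := by
    rw [integral_def]
    refine (Complex.reAddGroupHom.map_finsum (S.hasFiniteSupport_chartIntegral hc)).trans
      (finsum_congr fun i => ?_)
    exact (_root_.integral_re (𝕜 := ℂ) (S.integrableOn_chartIntegrand hf hc i)).symm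
  have hval : ∀ i y, (S.chartIntegrand f i y).re =
      chartPartition n M i ((extChartAt (𝓡 n) i).symm y) * S.density i y *
        (f ((extChartAt (𝓡 n) i).symm y)).re := fun i y => by
    rw [chartIntegrand, Complex.re_ofReal_mul]
  have hnn : ∀ i y, 0 ≤ (S.chartIntegrand f i y).re := fun i y => by
    rw [hval]
    exact mul_nonneg (mul_nonneg ((chartPartition n M).nonneg i _) (Real.sqrt_nonneg _)) (h0 _)
  have hfin : (Function.support fun i : M => ∫ y in (extChartAt (𝓡 n) i).target,
      (S.chartIntegrand f i y).re).Finite := by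
    refine (S.hasFiniteSupport_chartIntegral hc).subset fun i hi h => hi ?_
    have := _root_.integral_re (𝕜 := ℂ) (S.integrableOn_chartIntegrand hf hc i)
    exact this.trans ((congrArg Complex.re h).trans Complex.zero_re)
  -- All charts contribute nonnegatively; one whose partition function is positive at `x`
  -- contributes strictly, its integrand being positive on a neighbourhood of `φ x`.
  obtain ⟨i, hi⟩ := (chartPartition n M).exists_pos_of_mem (mem_univ x)
  rw [hre]
  refine finsum_pos (fun i => integral_nonneg (hnn i)) ⟨i, ?_⟩ hfin
  set φ := extChartAt (𝓡 n) i
  have hxs : x ∈ φ.source := tsupport_chartPartition_subset i (subset_tsupport _ hi.ne')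
  have hcont : ContinuousOn (fun y => (S.chartIntegrand f i y).re) φ.target :=
    Complex.continuous_re.comp_continuousOn (S.continuousOn_chartIntegrand hf i)
  have hpos : 0 < (S.chartIntegrand f i (φ x)).re := by
    rw [hval, φ.left_inv hxs]
    exact mul_pos (mul_pos hi (S.density_pos (φ.map_source hxs))) hx
  rw [setIntegral_pos_iff_support_of_nonneg_ae (Eventually.of_forall (hnn i))
    (S.integrableOn_chartIntegrand hf hc i).re]
  have hnhds : φ.target ∈ 𝓝 (φ x) :=
    (isOpen_extChartAt_target i).mem_nhds (φ.map_source hxs)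
  have hev := (hcont.continuousAt hnhds).eventually (lt_mem_nhds hpos)
  refine Measure.measure_pos_of_mem_nhds _ (x := φ x) ?_
  filter_upwards [hev, hnhds] with y h1 h2
  exact ⟨h1.ne', h2⟩

end Integral

end Spacetime

/-! ### Nondegeneracy of the pairing and uniqueness of formal adjoints -/

section FormalAdjoint

variable {n : ℕ} {M : Type*} [TopologicalSpace M] [ChartedSpace (EuclideanSpace ℝ (Fin n)) M]
  [IsManifold (𝓡 n) ∞ M] [T2Space M] [SigmaCompactSpace M]
  {F : Type*} [NormedAddCommGroup F] [NormedSpace ℂ F]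
  {V : M → Type*} [TopologicalSpace (TotalSpace F V)] [∀ x, AddCommGroup (V x)]
  [∀ x, Module ℂ (V x)] [∀ x, TopologicalSpace (V x)] [FiberBundle F V] [VectorBundle ℂ F V]
  {F' : Type*} [NormedAddCommGroup F'] [NormedSpace ℂ F']
  {W : M → Type*} [TopologicalSpace (TotalSpace F' W)] [∀ x, AddCommGroup (W x)]
  [∀ x, Module ℂ (W x)] [∀ x, TopologicalSpace (W x)] [FiberBundle F' W] [VectorBundle ℂ F' W]
  (S : Spacetime n M) (h : HermitianStructure n F V) (k : HermitianStructure n F' W)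

/-- In a smooth bundle, every vector is the value of a smooth section. -/
theorem exists_sec_apply_eq [SmoothComplexBundle n F V] (x : M) (v : V x) :
    ∃ s : Sec n F V, s.1 x = v := by
  set e := trivializationAt F V x
  have hx : x ∈ e.baseSet := mem_baseSet_trivializationAt F V x
  set c : F := (e ⟨x, v⟩).2
  obtain ⟨f, hf1, -, hfU, -⟩ := exists_cutoff (n := n) (isCompact_singleton (x := x))
    e.open_baseSet (by simpa using hx)
  -- The section with constant components `c` in the trivialization at `x`, cut off inside its
  -- domain. It is smooth there by smoothness of the coordinate changes, and it vanishes near every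
  -- point outside.
  have hs : (fun y => ((f y : ℝ) : ℂ) • e.symm y c) ∈ Sec n F V := by
    intro x₁
    refine (contMDiffAt_section x₁).2 ?_
    set e₁ := trivializationAt F V x₁
    have hx₁ : x₁ ∈ e₁.baseSet := mem_baseSet_trivializationAt F V x₁
    by_cases hx₁e : x₁ ∈ e.baseSet
    · have hopen : e.baseSet ∩ e₁.baseSet ∈ 𝓝 x₁ :=
        (e.open_baseSet.inter e₁.open_baseSet).mem_nhds ⟨hx₁e, hx₁⟩
      have hc := (SmoothComplexBundle.contMDiffOn_coordChangeL (n := n) e e₁).contMDiffAt hopen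
      have hev : ContMDiff 𝓘(ℝ, F →L[ℂ] F) 𝓘(ℝ, F) ∞ (fun A : F →L[ℂ] F => A c) :=
        ((ContinuousLinearMap.apply ℂ F c).restrictScalars ℝ).contDiff.contMDiff
      have hcc := hev.contMDiffAt.comp x₁ hc
      refine (((f.contMDiff x₁).smul hcc).congr_of_eventuallyEq ?_)
      filter_upwards [hopen] with y hy
      refine ((e₁.linear ℂ hy.2).2 _ _).trans ?_
      have := e.coordChangeL_apply (R := ℂ) e₁ hy c
      change ((f y : ℝ) : ℂ) • (e₁ ⟨y, e.symm y c⟩).2 = f y • (e.coordChangeL ℂ e₁ y c)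
      rw [this, Complex.coe_smul]
    · refine (contMDiffAt_const (c := (0 : F))).congr_of_eventuallyEq ?_
      filter_upwards [e₁.open_baseSet.mem_nhds hx₁, (isClosed_tsupport f).isOpen_compl.mem_nhds
        fun h => hx₁e (hfU h)] with y hy hyf
      refine ((e₁.linear ℂ hy).2 _ _).trans ?_
      rw [image_eq_zero_of_notMem_tsupport hyf]
      simp
  refine ⟨⟨_, hs⟩, ?_⟩
  have hfx : f x = 1 := hf1.self_of_nhdsSet x rfl
  change ((f x : ℝ) : ℂ) • e.symm x c = v
  rw [hfx, Complex.ofReal_one, one_smul]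
  exact e.symm_apply_apply_mk hx v

theorem continuous_form (u v : Sec n F V) : Continuous fun x => h.form x (u.1 x) (v.1 x) :=
  (h.contMDiff u v).continuous

theorem hasCompactSupport_form_right (u : Sec n F V) {v : Sec n F V} (hv : v ∈ CSec n F V) :
    HasCompactSupport fun x => h.form x (u.1 x) (v.1 x) :=
  IsCompact.of_isClosed_subset hv isClosed_closure
    (closure_mono fun x hx h0 => hx (by simp only [h0, map_zero]))

variable {S h k}

theorem pairing_conj (u v : Sec n F V) :
    (starRingEnd ℂ) (pairing S h u v) = pairing S h v u := by
  rw [pairing, ← S.integral_conj]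
  simp only [h.symm]
  rfl

theorem pairing_add_left (u u' : Sec n F V) {v : Sec n F V} (hv : v ∈ CSec n F V) :
    pairing S h (u + u') v = pairing S h u v + pairing S h u' v := by
  rw [pairing, pairing, pairing, ← S.integral_add (continuous_form h u v)
    (hasCompactSupport_form_right h u hv) (continuous_form h u' v)
    (hasCompactSupport_form_right h u' hv)]
  congr 1
  ext x
  change h.form x (u.1 x + u'.1 x) (v.1 x) = _
  rw [map_add, LinearMap.add_apply]

theorem pairing_smul_right (c : ℂ) (u v : Sec n F V) :
    pairing S h u (c • v) = c * pairing S h u v := by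
  rw [pairing, pairing, ← S.integral_const_mul]
  congr 1
  ext x
  change h.form x (u.1 x) (c • v.1 x) = _
  rw [map_smul, smul_eq_mul]

theorem pairing_add_right {u : Sec n F V} (hu : u ∈ CSec n F V) (v v' : Sec n F V) :
    pairing S h u (v + v') = pairing S h u v + pairing S h u v' := by
  rw [← pairing_conj, pairing_add_left v v' hu, map_add, pairing_conj, pairing_conj]

theorem pairing_smul_left (c : ℂ) (u v : Sec n F V) :
    pairing S h (c • u) v = (starRingEnd ℂ) c * pairing S h u v := by
  rw [← pairing_conj, pairing_smul_right, map_mul, pairing_conj]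

theorem pairing_zero_right (u : Sec n F V) : pairing S h u 0 = 0 := by
  have := pairing_smul_right (S := S) (h := h) 0 u 0
  rwa [zero_smul, zero_mul] at this

theorem fstSec_mem_cSec {u : Sec n (F × F') (V ×ᵇ W)} (hu : u ∈ CSec n (F × F') (V ×ᵇ W)) :
    fstSec u ∈ CSec n F V := (fstCSec ⟨u, hu⟩).2

theorem sndSec_mem_cSec {u : Sec n (F × F') (V ×ᵇ W)} (hu : u ∈ CSec n (F × F') (V ×ᵇ W)) :
    sndSec u ∈ CSec n F' W := (sndCSec ⟨u, hu⟩).2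

theorem pairing_prod (u : Sec n (F × F') (V ×ᵇ W)) {v : Sec n (F × F') (V ×ᵇ W)}
    (hv : v ∈ CSec n (F × F') (V ×ᵇ W)) :
    pairing S (h.prod k) u v =
      pairing S h (fstSec u) (fstSec v) + pairing S k (sndSec u) (sndSec v) := by
  rw [pairing, pairing, pairing, ← S.integral_add (continuous_form h _ _)
    (hasCompactSupport_form_right h _ (fstSec_mem_cSec hv)) (continuous_form k _ _)
    (hasCompactSupport_form_right k _ (sndSec_mem_cSec hv))]
  rfl

/-- The pairing with compactly supported sections is nondegenerate. -/
theorem eq_zero_of_pairing_eq_zero (hev : ∀ x (v : V x), ∃ s : Sec n F V, s.1 x = v)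
    {w : Sec n F V} (hw : ∀ u : CSec n F V, pairing S h w u = 0) : w = 0 := by
  by_contra hne
  obtain ⟨x, hx⟩ : ∃ x, w.1 x ≠ 0 := by
    by_contra! h0
    exact hne (Subtype.ext (funext h0))
  obtain ⟨v, hv⟩ : ∃ v, h.form x (w.1 x) v ≠ 0 := by
    by_contra! h0
    exact hx (h.nondegenerate x _ h0)
  obtain ⟨s, rfl⟩ := hev x v
  -- Normalized so that the form of `w` and `t` equals one at `x`. Cutting `t` off where the real
  -- part stays positive gives a test section with a nonnegative integrand that is positive at `x`.
  set t : Sec n F V := (h.form x (w.1 x) (s.1 x))⁻¹ • s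
  set g : M → ℂ := fun y => h.form y (w.1 y) (t.1 y)
  have hg : Continuous g := continuous_form h w t
  have hgx : g x = 1 := by
    change h.form x (w.1 x) ((h.form x (w.1 x) (s.1 x))⁻¹ • s.1 x) = 1
    rw [map_smul, smul_eq_mul, inv_mul_cancel₀ hv]
  have hU : IsOpen {y | 0 < (g y).re} := isOpen_lt continuous_const (Complex.continuous_re.comp hg)
  obtain ⟨f, hf1, hfc, hfU, hf⟩ := exists_cutoff (n := n) (isCompact_singleton (x := x)) hU
    (by simp [hgx])
  have hfx : f x = 1 := hf1.self_of_nhdsSet x rfl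
  have hu := mulSec_mem_cSec hfc t
  have hre : ∀ y, (h.form y (w.1 y) ((mulSec n F V f t).1 y)).re = f y * (g y).re := by
    intro y
    rw [mulSec_apply, map_smul, smul_eq_mul, Complex.re_ofReal_mul]
  have hpos : 0 < (pairing S h w (mulSec n F V f t)).re := by
    refine S.integral_re_pos (continuous_form h _ _) (hasCompactSupport_form_right h _ hu)
      (fun y => ?_) (x := x) ?_
    · rw [hre]
      by_cases hy : y ∈ tsupport f
      · exact mul_nonneg (hf y).1 (hfU hy).le
      · rw [image_eq_zero_of_notMem_tsupport hy, zero_mul]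
    · rw [hre, hfx, hgx]; simp
  have := hw ⟨_, hu⟩
  rw [this] at hpos
  exact lt_irrefl _ hpos

theorem eq_of_pairing_eq (hev : ∀ x (v : V x), ∃ s : Sec n F V, s.1 x = v)
    {w w' : Sec n F V} (hw : ∀ u : CSec n F V, pairing S h w u = pairing S h w' u) : w = w' := by
  have h0 : w - w' = 0 := eq_zero_of_pairing_eq_zero (S := S) (h := h) hev fun u => by
    have h1 := pairing_add_left (S := S) (h := h) (w - w') w' u.2
    rw [sub_add_cancel, hw] at h1
    exact right_eq_add.1 h1
  exact sub_eq_zero.1 h0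

variable {A : Sec n F V →ₗ[ℂ] Sec n F' W} {B B' : Sec n F' W →ₗ[ℂ] Sec n F V}

/-- A differential operator has at most one differential operator as its formal adjoint. -/
theorem IsFormalAdjoint.unique (hev : ∀ x (v : V x), ∃ s : Sec n F V, s.1 x = v)
    (hB : IsDiffOp B) (hB' : IsDiffOp B') (hA : IsFormalAdjoint S h k A B)
    (hA' : IsFormalAdjoint S h k A B') : B = B' :=
  hB.ext hB' fun v => eq_of_pairing_eq (S := S) (h := h) hev fun u => (hA u v).trans (hA' u v).symm

theorem formalAdjoint_eq (hev : ∀ x (v : V x), ∃ s : Sec n F V, s.1 x = v)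
    (hB : IsDiffOp B) (hA : IsFormalAdjoint S h k A B) : formalAdjoint S h k A = B := by
  have hex : ∃ B, IsDiffOp B ∧ IsFormalAdjoint S h k A B := ⟨B, hB, hA⟩
  rw [formalAdjoint, dif_pos hex]
  exact IsFormalAdjoint.unique hev hex.choose_spec.1 hB hex.choose_spec.2 hA

/-- A nonzero value cannot come from the default branch of the definition, so an adjoint exists and
has been chosen. -/
theorem formalAdjoint_spec (hA : formalAdjoint S h k A ≠ 0) :
    IsDiffOp (formalAdjoint S h k A) ∧ IsFormalAdjoint S h k A (formalAdjoint S h k A) := by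
  have hex : ∃ B, IsDiffOp B ∧ IsFormalAdjoint S h k A B := by
    by_contra hex
    exact hA (by rw [formalAdjoint, dif_neg hex])
  rw [formalAdjoint, dif_pos hex]
  exact hex.choose_spec

theorem IsFormalAdjoint.symm (hA : IsFormalAdjoint S h k A B) : IsFormalAdjoint S k h B A := by
  intro v u
  rw [← pairing_conj, ← hA u v, pairing_conj]

end FormalAdjoint

/-! ### Self-adjointness of the block operator -/

section Block

variable {n : ℕ} {M : Type*} [TopologicalSpace M] [ChartedSpace (EuclideanSpace ℝ (Fin n)) M]
  [IsManifold (𝓡 n) ∞ M] [T2Space M] [SigmaCompactSpace M]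
  {F₀ : Type*} [NormedAddCommGroup F₀] [NormedSpace ℂ F₀]
  {V₀ : M → Type*} [TopologicalSpace (TotalSpace F₀ V₀)] [∀ x, AddCommGroup (V₀ x)]
  [∀ x, Module ℂ (V₀ x)] [∀ x, TopologicalSpace (V₀ x)] [FiberBundle F₀ V₀] [VectorBundle ℂ F₀ V₀]
  {F₁ : Type*} [NormedAddCommGroup F₁] [NormedSpace ℂ F₁]
  {V₁ : M → Type*} [TopologicalSpace (TotalSpace F₁ V₁)] [∀ x, AddCommGroup (V₁ x)]
  [∀ x, Module ℂ (V₁ x)] [∀ x, TopologicalSpace (V₁ x)] [FiberBundle F₁ V₁] [VectorBundle ℂ F₁ V₁]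
  {S : Spacetime n M} {h₀ : HermitianStructure n F₀ V₀} {h₁ : HermitianStructure n F₁ V₁}
  {P : Sec n F₁ V₁ →ₗ[ℂ] Sec n F₁ V₁} {K : Sec n F₀ V₀ →ₗ[ℂ] Sec n F₁ V₁}
  {Ks : Sec n F₁ V₁ →ₗ[ℂ] Sec n F₀ V₀}

theorem pairing_gaugeHermitian (u : GaugeSec n F₀ V₀ F₁ V₁) (v : GaugeCSec n F₀ V₀ F₁ V₁) :
    pairing S (gaugeHermitian h₀ h₁) u v =
      pairing S h₁ (compA u) (compA v.1) + (pairing S h₀ (compB u) (compB v.1) +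
        (pairing S h₀ (compC u) (compC v.1) + pairing S h₀ (compD u) (compD v.1))) := by
  rw [gaugeHermitian, pairing_prod _ v.2, pairing_prod _ (sndSec_mem_cSec v.2),
    pairing_prod _ (sndSec_mem_cSec (sndSec_mem_cSec v.2))]
  rfl

theorem pairing_gaugeHermitian' (u : GaugeCSec n F₀ V₀ F₁ V₁) (v : GaugeSec n F₀ V₀ F₁ V₁) :
    pairing S (gaugeHermitian h₀ h₁) u v =
      pairing S h₁ (compA u.1) (compA v) + (pairing S h₀ (compB u.1) (compB v) +
        (pairing S h₀ (compC u.1) (compC v) + pairing S h₀ (compD u.1) (compD v))) := by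
  rw [← pairing_conj, pairing_gaugeHermitian]
  simp only [map_add, pairing_conj]

theorem compA_blockOperator (α : ℝ) (u : GaugeSec n F₀ V₀ F₁ V₁) :
    compA (blockOperator P K Ks α u) = P (compA u) + K (compB u) := rfl

theorem compB_blockOperator (α : ℝ) (u : GaugeSec n F₀ V₀ F₁ V₁) :
    compB (blockOperator P K Ks α u) = Ks (compA u) - (α : ℂ) • compB u := rfl

theorem compC_blockOperator (α : ℝ) (u : GaugeSec n F₀ V₀ F₁ V₁) :
    compC (blockOperator P K Ks α u) = Ks (K (compD u)) := rfl

theorem compD_blockOperator (α : ℝ) (u : GaugeSec n F₀ V₀ F₁ V₁) :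
    compD (blockOperator P K Ks α u) = Ks (K (compC u)) := rfl

theorem compA_mem_cSec (u : GaugeCSec n F₀ V₀ F₁ V₁) : compA u.1 ∈ CSec n F₁ V₁ := (fstCSec u).2

theorem compB_mem_cSec (u : GaugeCSec n F₀ V₀ F₁ V₁) : compB u.1 ∈ CSec n F₀ V₀ :=
  (fstCSec (sndCSec u)).2

theorem compC_mem_cSec (u : GaugeCSec n F₀ V₀ F₁ V₁) : compC u.1 ∈ CSec n F₀ V₀ :=
  (fstCSec (sndCSec (sndCSec u))).2

theorem compD_mem_cSec (u : GaugeCSec n F₀ V₀ F₁ V₁) : compD u.1 ∈ CSec n F₀ V₀ :=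
  (sndCSec (sndCSec (sndCSec u))).2

/-- Symmetry of `K*K`, for the two off-diagonal blocks, which the adjoint exchanges. -/
theorem IsFormalAdjoint.comp_self (hK : IsDiffOp K) (hKs : IsFormalAdjoint S h₀ h₁ K Ks)
    {u v : Sec n F₀ V₀} (hu : u ∈ CSec n F₀ V₀) (hv : v ∈ CSec n F₀ V₀) :
    pairing S h₀ (Ks (K v)) u = pairing S h₀ v (Ks (K u)) :=
  (hKs ⟨u, hu⟩ ⟨K v, hK.mem_cSec hv⟩).trans (hKs.symm ⟨K u, hK.mem_cSec hu⟩ ⟨v, hv⟩)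

/-- The block operator is formally self-adjoint. -/
theorem isFormalAdjoint_blockOperator (hP : IsFormalAdjoint S h₁ h₁ P P) (hK : IsDiffOp K)
    (hKs : IsFormalAdjoint S h₀ h₁ K Ks) (α : ℝ) :
    IsFormalAdjoint S (gaugeHermitian h₀ h₁) (gaugeHermitian h₀ h₁) (blockOperator P K Ks α)
      (blockOperator P K Ks α) := by
  intro u v
  have ua := compA_mem_cSec u
  have ub := compB_mem_cSec u
  have va := compA_mem_cSec v
  have vb := compB_mem_cSec v
  -- Writes the diagonal entry as a scalar multiple, to which the semilinearity lemmas apply; `α`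
  -- being real, conjugation fixes it.
  have e : ∀ (a : Sec n F₁ V₁) (b : Sec n F₀ V₀), Ks a - (α : ℂ) • b = Ks a + (-(α : ℂ)) • b :=
    fun a b => by module
  rw [pairing_gaugeHermitian, pairing_gaugeHermitian']
  simp only [compA_blockOperator, compB_blockOperator, compC_blockOperator, compD_blockOperator, e]
  rw [pairing_add_left _ _ ua, pairing_add_left _ _ ub, pairing_add_right va, pairing_add_right vb,
    pairing_smul_left, pairing_smul_right,
    hKs.comp_self hK (compC_mem_cSec u) (compD_mem_cSec v),
    hKs.comp_self hK (compD_mem_cSec u) (compC_mem_cSec v), hP ⟨_, ua⟩ ⟨_, va⟩,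
    hKs ⟨_, ub⟩ ⟨_, va⟩, hKs.symm ⟨_, ua⟩ ⟨_, vb⟩]
  simp only [map_neg, Complex.conj_ofReal]
  ring

/-- Built componentwise, which avoids showing that the direct sum is a smooth bundle; for this
reason the uniqueness lemmas assume pointwise surjectivity of evaluation instead. -/
theorem exists_gaugeSec_apply_eq [SmoothComplexBundle n F₀ V₀] [SmoothComplexBundle n F₁ V₁]
    (x : M) (v : V₁ x × V₀ x × V₀ x × V₀ x) : ∃ s : GaugeSec n F₀ V₀ F₁ V₁, s.1 x = v := by
  obtain ⟨a, ha⟩ := exists_sec_apply_eq (n := n) (F := F₁) x v.1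
  obtain ⟨b, hb⟩ := exists_sec_apply_eq (n := n) (F := F₀) x v.2.1
  obtain ⟨c, hc⟩ := exists_sec_apply_eq (n := n) (F := F₀) x v.2.2.1
  obtain ⟨d, hd⟩ := exists_sec_apply_eq (n := n) (F := F₀) x v.2.2.2
  refine ⟨pairSec (a, pairSec (b, pairSec (c, d))), ?_⟩
  change (a.1 x, b.1 x, c.1 x, d.1 x) = v
  rw [ha, hb, hc, hd]

/-- Against a test section, `(K*Pv|u) = (Pv|Ku) = (v|PKu) = 0`, and the pairing is nondegenerate. -/
theorem comp_eq_zero_of_adjoint [SmoothComplexBundle n F₀ V₀] (hPd : IsDiffOp P)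
    (hKsd : IsDiffOp Ks) (hP : IsFormalAdjoint S h₁ h₁ P P) (hK : IsDiffOp K)
    (hKs : IsFormalAdjoint S h₀ h₁ K Ks) (hPK : P ∘ₗ K = 0) : Ks ∘ₗ P = 0 := by
  refine (hKsd.comp hPd).ext isDiffOp_zero fun v =>
    eq_zero_of_pairing_eq_zero (S := S) (h := h₀) exists_sec_apply_eq fun u => ?_
  have h1 := hKs u ⟨P v, hPd.mem_cSec v.2⟩
  have h2 := hP ⟨K u, hK.mem_cSec u.2⟩ v
  have h3 : P (K u) = 0 := LinearMap.congr_fun hPK u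
  exact (h1.trans h2).trans (by rw [h3, pairing_zero_right])

end Block

/-! ### The propagators of the block operator -/

section Gauge

variable {n : ℕ} {M : Type*} [TopologicalSpace M] [ChartedSpace (EuclideanSpace ℝ (Fin n)) M]
  [IsManifold (𝓡 n) ∞ M] [T2Space M] [SigmaCompactSpace M]
  {F₀ : Type*} [NormedAddCommGroup F₀] [NormedSpace ℂ F₀]
  {V₀ : M → Type*} [TopologicalSpace (TotalSpace F₀ V₀)] [∀ x, AddCommGroup (V₀ x)]
  [∀ x, Module ℂ (V₀ x)] [∀ x, TopologicalSpace (V₀ x)] [FiberBundle F₀ V₀] [VectorBundle ℂ F₀ V₀]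
  {F₁ : Type*} [NormedAddCommGroup F₁] [NormedSpace ℂ F₁]
  {V₁ : M → Type*} [TopologicalSpace (TotalSpace F₁ V₁)] [∀ x, AddCommGroup (V₁ x)]
  [∀ x, Module ℂ (V₁ x)] [∀ x, TopologicalSpace (V₁ x)] [FiberBundle F₁ V₁] [VectorBundle ℂ F₁ V₁]
  {S : Spacetime n M} {τ : TimeDir}
  {P : Sec n F₁ V₁ →ₗ[ℂ] Sec n F₁ V₁} {K : Sec n F₀ V₀ →ₗ[ℂ] Sec n F₁ V₁}
  {Ks : Sec n F₁ V₁ →ₗ[ℂ] Sec n F₀ V₀}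
  {G_D : CSec n F₁ V₁ →ₗ[ℂ] Sec n F₁ V₁} {G_Q : CSec n F₀ V₀ →ₗ[ℂ] Sec n F₀ V₀}
  {G_Dx : CausalSec F₁ V₁ S τ →ₗ[ℂ] CausalSec F₁ V₁ S τ}

theorem gaugeSec_ext {u v : GaugeSec n F₀ V₀ F₁ V₁} (hA : compA u = compA v)
    (hB : compB u = compB v) (hC : compC u = compC v) (hD : compD u = compD v) : u = v := by
  ext x
  · exact congrFun (congrArg Subtype.val hA) x
  · exact congrFun (congrArg Subtype.val hB) x
  · exact congrFun (congrArg Subtype.val hC) x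
  · exact congrFun (congrArg Subtype.val hD) x

theorem supp_gaugeSec_subset {u : GaugeSec n F₀ V₀ F₁ V₁} {A : Set M}
    (hA : supp (compA u).1 ⊆ A) (hB : supp (compB u).1 ⊆ A) (hC : supp (compC u).1 ⊆ A)
    (hD : supp (compD u).1 ⊆ A) : supp u.1 ⊆ A := by
  intro x hx
  by_contra h
  refine notMem_supp_iff.2 ?_ hx
  filter_upwards [notMem_supp_iff.1 fun hx => h (hA hx), notMem_supp_iff.1 fun hx => h (hB hx),
    notMem_supp_iff.1 fun hx => h (hC hx), notMem_supp_iff.1 fun hx => h (hD hx)] with y a b c d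
  exact Prod.ext a (Prod.ext b (Prod.ext c d))

theorem IsDiffOp.mem_causalSec {F F' : Type*} [NormedAddCommGroup F] [NormedSpace ℂ F]
    {V : M → Type*} [TopologicalSpace (TotalSpace F V)] [∀ x, AddCommGroup (V x)]
    [∀ x, Module ℂ (V x)] [∀ x, TopologicalSpace (V x)] [FiberBundle F V] [VectorBundle ℂ F V]
    [NormedAddCommGroup F'] [NormedSpace ℂ F']
    {W : M → Type*} [TopologicalSpace (TotalSpace F' W)] [∀ x, AddCommGroup (W x)]
    [∀ x, Module ℂ (W x)] [∀ x, TopologicalSpace (W x)] [FiberBundle F' W] [VectorBundle ℂ F' W]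
    {A : Sec n F V →ₗ[ℂ] Sec n F' W} (hA : IsDiffOp A)
    {u : Sec n F V} (hu : u ∈ CausalSec F V S τ) : A u ∈ CausalSec F' W S τ :=
  CausalSec.mem_of_supp_subset hu ((hA.supp_subset u).trans (S.subset_J τ _))

/-- The block operator is injective on sections supported in `J^±(C)`, `C` compact. -/
theorem blockOperator_injOn_causalSec (hS : S.GloballyHyperbolic) (hP : IsDiffOp P)
    (hK : IsDiffOp K) (hKs : IsDiffOp Ks) (hKsP : Ks ∘ₗ P = 0)
    (hD : IsPropagator S τ (P + K ∘ₗ Ks) G_D) (hQ : IsPropagator S τ (Ks ∘ₗ K) G_Q) (α : ℝ)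
    {v w : GaugeSec n F₀ V₀ F₁ V₁} (hv : v ∈ CausalSec _ _ S τ) (hw : w ∈ CausalSec _ _ S τ)
    (h : blockOperator P K Ks α v = blockOperator P K Ks α w) : v = w := by
  have hQd : IsDiffOp (Ks ∘ₗ K) := hKs.comp hK
  have hDd : IsDiffOp (P + K ∘ₗ Ks) := hP.add (hK.comp hKs)
  have hz : v - w ∈ CausalSec _ _ S τ := Submodule.sub_mem _ hv hw
  have hLz : blockOperator P K Ks α (v - w) = 0 := by rw [map_sub, h, sub_self]
  set z := v - w
  have hA : P (compA z) + K (compB z) = 0 := congrArg compA hLz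
  have hB : Ks (compA z) - (α : ℂ) • compB z = 0 := congrArg compB hLz
  have hC : Ks (K (compD z)) = 0 := congrArg compC hLz
  have hD' : Ks (K (compC z)) = 0 := congrArg compD hLz
  have zc : compC z = 0 := hQ.injOn_causalSec hQd hS (isDiffOp_compC.mem_causalSec hz)
    (Submodule.zero_mem _) (hD'.trans (map_zero _).symm)
  have zd : compD z = 0 := hQ.injOn_causalSec hQd hS (isDiffOp_compD.mem_causalSec hz)
    (Submodule.zero_mem _) (hC.trans (map_zero _).symm)
  -- Applying `K*` to the first row kills the `P` term and leaves `K*K b = 0`.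
  have zb : compB z = 0 := by
    refine hQ.injOn_causalSec hQd hS (isDiffOp_compB.mem_causalSec hz)
      (Submodule.zero_mem _) ?_
    have h1 : Ks (P (compA z)) = 0 := LinearMap.congr_fun hKsP _
    have h2 := congrArg Ks hA
    rw [map_add, h1, zero_add, map_zero] at h2
    exact h2.trans (map_zero _).symm
  -- With `b = 0` the first two rows become `Pa = 0` and `K*a = 0`, so `Da = 0`.
  have za : compA z = 0 := by
    refine hD.injOn_causalSec hDd hS (isDiffOp_compA.mem_causalSec hz)
      (Submodule.zero_mem _) ?_
    rw [zb, map_zero, add_zero] at hA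
    rw [zb, smul_zero, sub_zero] at hB
    change P (compA z) + K (Ks (compA z)) = _
    rw [hA, hB, map_zero, map_zero, add_zero]
  exact sub_eq_zero.1 (gaugeSec_ext (v := 0) za zb zc zd)

theorem source_mem_causalSec (hK : IsDiffOp K) (hKs : IsDiffOp Ks)
    (hD : IsPropagator S τ (P + K ∘ₗ Ks) G_D) (c : ℂ) (u : CSec n F₁ V₁) :
    (u : Sec n F₁ V₁) + c • K (Ks (G_D u)) ∈ CausalSec F₁ V₁ S τ :=
  Submodule.add_mem _ (CSec.mem_causalSec S τ u.2)
    (Submodule.smul_mem _ _ (hK.mem_causalSec (hKs.mem_causalSec (hD.mem_causalSec u))))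

theorem exists_isBlockPropagator (hK : IsDiffOp K) (hKs : IsDiffOp Ks)
    (hD : IsPropagator S τ (P + K ∘ₗ Ks) G_D) (α : ℝ)
    (G_Dx : CausalSec F₁ V₁ S τ →ₗ[ℂ] CausalSec F₁ V₁ S τ)
    (G_Q : CSec n F₀ V₀ →ₗ[ℂ] Sec n F₀ V₀) :
    ∃ G_L : GaugeCSec n F₀ V₀ F₁ V₁ →ₗ[ℂ] GaugeSec n F₀ V₀ F₁ V₁,
      IsBlockPropagator S τ K Ks α G_D G_Dx G_Q G_L := by
  let src : CSec n F₁ V₁ →ₗ[ℂ] CausalSec F₁ V₁ S τ :=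
    ((CSec n F₁ V₁).subtype + ((α : ℂ) - 1) • (K ∘ₗ Ks ∘ₗ G_D)).codRestrict _
      (source_mem_causalSec hK hKs hD ((α : ℂ) - 1))
  refine ⟨pairSec ∘ₗ ((CausalSec F₁ V₁ S τ).subtype ∘ₗ G_Dx ∘ₗ src ∘ₗ fstCSec +
      K ∘ₗ G_Q ∘ₗ fstCSec ∘ₗ sndCSec).prod
    (pairSec ∘ₗ (Ks ∘ₗ G_D ∘ₗ fstCSec).prod
      (pairSec ∘ₗ (G_Q ∘ₗ sndCSec ∘ₗ sndCSec ∘ₗ sndCSec).prod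
        (G_Q ∘ₗ fstCSec ∘ₗ sndCSec ∘ₗ sndCSec))), fun f => ?_⟩
  exact ⟨⟨src (fstCSec f), rfl, rfl⟩, rfl, rfl, rfl⟩

/-- The relation `K*D = QK*` determines `K*` of the first component; the correction `(α - 1)KK*G_D`
is what makes the second row absorb the entry `-α`. -/
theorem IsBlockPropagator.isPropagator (hS : S.GloballyHyperbolic) (hP : IsDiffOp P)
    (hK : IsDiffOp K) (hKs : IsDiffOp Ks) (hPK : P ∘ₗ K = 0) (hKsP : Ks ∘ₗ P = 0)
    (hD : IsPropagator S τ (P + K ∘ₗ Ks) G_D) (hQ : IsPropagator S τ (Ks ∘ₗ K) G_Q)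
    (hDx : IsExtendedPropagator S τ (P + K ∘ₗ Ks) G_D G_Dx) {α : ℝ}
    {G_L : GaugeCSec n F₀ V₀ F₁ V₁ →ₗ[ℂ] GaugeSec n F₀ V₀ F₁ V₁}
    (hL : IsBlockPropagator S τ K Ks α G_D G_Dx G_Q G_L) :
    IsPropagator S τ (blockOperator P K Ks α) G_L := by
  have hLd : IsDiffOp (blockOperator P K Ks α) := isDiffOp_blockOperator hP hK hKs α
  have right (f : GaugeCSec n F₀ V₀ F₁ V₁) : blockOperator P K Ks α (G_L f) = f := by
    obtain ⟨⟨w, hw, hA⟩, hB, hC, hD'⟩ := hL f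
    set fa : CSec n F₁ V₁ := fstCSec f
    set fb : CSec n F₀ V₀ := fstCSec (sndCSec f)
    set X := G_D fa
    set Z : Sec n F₁ V₁ := (G_Dx w).1
    have eX : P X + K (Ks X) = fa := hD.right_inv fa
    have eZ : P Z + K (Ks Z) = fa + ((α : ℂ) - 1) • K (Ks X) := (hDx.right_inv w).trans hw
    have eKsP (u : Sec n F₁ V₁) : Ks (P u) = 0 := LinearMap.congr_fun hKsP u
    have eQ : Ks (K (G_Q fb)) = fb := hQ.right_inv fb
    -- Both sides have the same image under `Q`: `K*` applied to the equations for `X` and `Z` gives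
    -- `QK*X = K*fa` and `QK*Z = K*fa + (α - 1)QK*X`.
    have eKs : Ks Z = (α : ℂ) • Ks X := by
      refine hQ.injOn_causalSec (hKs.comp hK) hS (hKs.mem_causalSec (G_Dx w).2)
        (Submodule.smul_mem _ _ (hKs.mem_causalSec (hD.mem_causalSec fa))) ?_
      have h1 := congrArg Ks eX
      have h2 := congrArg Ks eZ
      rw [map_add, eKsP, zero_add] at h1 h2
      rw [map_add, ← h1, map_smul] at h2
      change Ks (K (Ks Z)) = Ks (K ((α : ℂ) • Ks X))
      rw [h2, map_smul, map_smul]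
      module
    have ePZ : P Z = fa - K (Ks X) := by
      rw [eKs, map_smul] at eZ
      rw [eq_sub_of_add_eq eZ]
      module
    refine gaugeSec_ext ?_ ?_ ?_ ?_
    · have h0 : P (K (G_Q fb)) = 0 := LinearMap.congr_fun hPK _
      rw [compA_blockOperator, hA, hB, map_add, h0, ePZ, add_zero, sub_add_cancel]
      rfl
    · rw [compB_blockOperator, hA, hB, map_add, eKs, eQ, add_sub_cancel_left]
      rfl
    · rw [compC_blockOperator, hD']
      exact hQ.right_inv _
    · rw [compD_blockOperator, hC]
      exact hQ.right_inv _
  have hsupp (f : GaugeCSec n F₀ V₀ F₁ V₁) : supp (G_L f).1 ⊆ S.J τ (supp f.1.1) := by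
    obtain ⟨⟨w, hw, hA⟩, hB, hC, hD'⟩ := hL f
    have hGD (u : CSec n F₁ V₁) (hu : supp u.1.1 ⊆ supp f.1.1) :
        supp (G_D u).1 ⊆ S.J τ (supp f.1.1) := (hD.supp_subset u).trans (S.J_mono τ hu)
    have hGQ (u : CSec n F₀ V₀) (hu : supp u.1.1 ⊆ supp f.1.1) :
        supp (G_Q u).1 ⊆ S.J τ (supp f.1.1) := (hQ.supp_subset u).trans (S.J_mono τ hu)
    have ha := isDiffOp_compA.supp_subset f.1
    have hb := isDiffOp_compB.supp_subset f.1
    have hc := isDiffOp_compC.supp_subset f.1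
    have hd := isDiffOp_compD.supp_subset f.1
    have hKX := hKs.supp_subset (G_D (fstCSec f))
    refine supp_gaugeSec_subset ?_ ?_ ?_ ?_
    · rw [hA]
      refine (supp_add_subset _ _).trans (union_subset ((hDx.supp_subset w).trans
        (S.J_subset_of_subset ?_)) ((hK.supp_subset _).trans (hGQ _ hb)))
      rw [hw]
      refine (supp_add_subset _ _).trans (union_subset (ha.trans (S.subset_J τ _)) ?_)
      exact (supp_smul_subset _ _).trans ((hK.supp_subset _).trans (hKX.trans (hGD _ ha)))
    · rw [hB]
      exact hKX.trans (hGD _ ha)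
    · rw [hC]
      exact hGQ _ hd
    · rw [hD']
      exact hGQ _ hc
  refine ⟨right, fun u hu => ?_, hsupp⟩
  -- The left inverse property follows from the right one: `G_L (L u)` and `u` are causal sections
  -- with the same image under the injective `L`.
  exact blockOperator_injOn_causalSec hS hP hK hKs hKsP hD hQ α
    (CausalSec.mem_of_supp_subset (CSec.mem_causalSec S τ hu) (hsupp ⟨_, hu⟩))
    (CSec.mem_causalSec S τ u.2) (right ⟨_, hu⟩)

/-- The block formula defines a propagator, and propagators are unique, so every propagator
satisfies the formula. -/
theorem isPropagator_blockOperator_iff (hS : S.GloballyHyperbolic) (hP : IsDiffOp P)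
    (hK : IsDiffOp K) (hKs : IsDiffOp Ks) (hPK : P ∘ₗ K = 0) (hKsP : Ks ∘ₗ P = 0)
    (hD : IsPropagator S τ (P + K ∘ₗ Ks) G_D) (hQ : IsPropagator S τ (Ks ∘ₗ K) G_Q)
    (hDx : IsExtendedPropagator S τ (P + K ∘ₗ Ks) G_D G_Dx) {α : ℝ}
    {G_L : GaugeCSec n F₀ V₀ F₁ V₁ →ₗ[ℂ] GaugeSec n F₀ V₀ F₁ V₁} :
    IsPropagator S τ (blockOperator P K Ks α) G_L ↔
      IsBlockPropagator S τ K Ks α G_D G_Dx G_Q G_L := by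
  refine ⟨fun h => ?_, fun h => h.isPropagator hS hP hK hKs hPK hKsP hD hQ hDx⟩
  obtain ⟨G', hG'⟩ := exists_isBlockPropagator hK hKs hD α G_Dx G_Q
  rwa [h.eq (isDiffOp_blockOperator hP hK hKs α) hS
    (hG'.isPropagator hS hP hK hKs hPK hKsP hD hQ hDx)]

/-- If `K*K` has a propagator and `K ≠ 0`, then `K*` is not the junk value zero. -/
theorem formalAdjoint_ne_zero {h₀ : HermitianStructure n F₀ V₀} {h₁ : HermitianStructure n F₁ V₁}
    (hK : IsDiffOp K) (hK0 : K ≠ 0)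
    (hQ : IsPropagator S τ (formalAdjoint S h₀ h₁ K ∘ₗ K) G_Q) : formalAdjoint S h₀ h₁ K ≠ 0 := by
  intro h0
  refine hK0 (hK.ext isDiffOp_zero fun u => ?_)
  have hu := hQ.right_inv u
  rw [h0, LinearMap.zero_comp] at hu
  rw [← hu, LinearMap.zero_apply, map_zero, LinearMap.zero_apply]

end Gauge

end GreenHyp

/-! ### The main theorem -/

theorem mainTheorem9 {n : ℕ} {M : Type*} [TopologicalSpace M]
    [ChartedSpace (EuclideanSpace ℝ (Fin n)) M] [IsManifold (𝓡 n) ∞ M] [T2Space M]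
    [SigmaCompactSpace M]
    {F₀ : Type*} [NormedAddCommGroup F₀] [NormedSpace ℂ F₀] [FiniteDimensional ℂ F₀]
    {V₀ : M → Type*} [TopologicalSpace (TotalSpace F₀ V₀)] [∀ x, AddCommGroup (V₀ x)]
    [∀ x, Module ℂ (V₀ x)] [∀ x, TopologicalSpace (V₀ x)] [FiberBundle F₀ V₀]
    [VectorBundle ℂ F₀ V₀] [GreenHyp.SmoothComplexBundle n F₀ V₀]
    {F₁ : Type*} [NormedAddCommGroup F₁] [NormedSpace ℂ F₁] [FiniteDimensional ℂ F₁]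
    {V₁ : M → Type*} [TopologicalSpace (TotalSpace F₁ V₁)] [∀ x, AddCommGroup (V₁ x)]
    [∀ x, Module ℂ (V₁ x)] [∀ x, TopologicalSpace (V₁ x)] [FiberBundle F₁ V₁]
    [VectorBundle ℂ F₁ V₁] [GreenHyp.SmoothComplexBundle n F₁ V₁]
    (S : GreenHyp.Spacetime n M) (hS : S.GloballyHyperbolic)
    (h₀ : GreenHyp.HermitianStructure n F₀ V₀) (h₁ : GreenHyp.HermitianStructure n F₁ V₁)
    (P : GreenHyp.Sec n F₁ V₁ →ₗ[ℂ] GreenHyp.Sec n F₁ V₁)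
    (K : GreenHyp.Sec n F₀ V₀ →ₗ[ℂ] GreenHyp.Sec n F₁ V₁)
    (hPK : GreenHyp.SubsidiaryHypothesis S h₀ h₁ P K K) (α : ℝ) :
    GreenHyp.BlockHypothesis S h₀ h₁ P K α ∧
      ∀ (τ : GreenHyp.TimeDir)
        (G_D : GreenHyp.CSec n F₁ V₁ →ₗ[ℂ] GreenHyp.Sec n F₁ V₁)
        (G_Q : GreenHyp.CSec n F₀ V₀ →ₗ[ℂ] GreenHyp.Sec n F₀ V₀),
        GreenHyp.IsPropagator S τ (P + K ∘ₗ GreenHyp.formalAdjoint S h₀ h₁ K) G_D →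
        GreenHyp.IsPropagator S τ (GreenHyp.formalAdjoint S h₀ h₁ K ∘ₗ K) G_Q →
        (∃! G_Dx, GreenHyp.IsExtendedPropagator S τ
          (P + K ∘ₗ GreenHyp.formalAdjoint S h₀ h₁ K) G_D G_Dx) ∧
        ∀ G_Dx, GreenHyp.IsExtendedPropagator S τ
            (P + K ∘ₗ GreenHyp.formalAdjoint S h₀ h₁ K) G_D G_Dx →
          ∀ G_L : GreenHyp.GaugeCSec n F₀ V₀ F₁ V₁ →ₗ[ℂ] GreenHyp.GaugeSec n F₀ V₀ F₁ V₁,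
            GreenHyp.IsPropagator S τ
                (GreenHyp.blockOperator P K (GreenHyp.formalAdjoint S h₀ h₁ K) α) G_L ↔
              GreenHyp.IsBlockPropagator S τ K (GreenHyp.formalAdjoint S h₀ h₁ K) α
                G_D G_Dx G_Q G_L := by
  have hP := hPK.isDiffOp_P
  have hK := hPK.isDiffOp_K
  -- One propagator of `K*K`, in either time direction, suffices to exclude the default value of
  -- `K*`.
  obtain ⟨_, hG⟩ := hPK.greenHyperbolic_Q.propagator .future
  obtain ⟨hKs, hKadj⟩ := GreenHyp.formalAdjoint_spec
    (GreenHyp.formalAdjoint_ne_zero hK hPK.K_ne_zero hG)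
  have hKsP := GreenHyp.comp_eq_zero_of_adjoint hP hKs hPK.selfAdjoint_P hK hKadj hPK.P_comp_K
  have hDd := hPK.greenHyperbolic_D.isDiffOp
  have hLd := GreenHyp.isDiffOp_blockOperator hP hK hKs α
  have hprop (τ : GreenHyp.TimeDir) : ∃ G_L, GreenHyp.IsPropagator S τ
      (GreenHyp.blockOperator P K (GreenHyp.formalAdjoint S h₀ h₁ K) α) G_L := by
    obtain ⟨G_D, hD⟩ := hPK.greenHyperbolic_D.propagator τ
    obtain ⟨G_Q, hQ⟩ := hPK.greenHyperbolic_Q.propagator τ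
    obtain ⟨G_L, hL⟩ := GreenHyp.exists_isBlockPropagator hK hKs hD α (hD.extend hS) G_Q
    exact ⟨G_L, hL.isPropagator hS hP hK hKs hPK.P_comp_K hKsP hD hQ
      (hD.isExtendedPropagator hDd hS)⟩
  refine ⟨⟨hP, hPK.selfAdjoint_P, hK, hPK.K_ne_zero, hPK.P_comp_K, hLd, hprop, fun τ => ?_⟩,
    fun τ G_D G_Q hD hQ => ⟨hD.existsUnique_extension hDd hS, fun G_Dx hDx G_L =>
      GreenHyp.isPropagator_blockOperator_iff hS hP hK hKs hPK.P_comp_K hKsP hD hQ hDx⟩⟩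
  -- By self-adjointness and uniqueness of the formal adjoint, `L*` is `L`, so the propagators
  -- already found serve for it.
  rw [GreenHyp.formalAdjoint_eq GreenHyp.exists_gaugeSec_apply_eq hLd
    (GreenHyp.isFormalAdjoint_blockOperator hPK.selfAdjoint_P hK hKadj α)]
  exact hprop τ
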